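/- For a permutation $\pi$ of $\{1,\dots,n\}$ let $G_\pi$ be the graph on $\{1,\dots,n\}$ in which $i$ and $j$ with $i<j$ are adjacent if and only if $\pi(i)<\pi(j)$ and there is no $k$ with $i<k<j$ and $\pi(i)<\pi(k)<\pi(j)$. Call $\pi$ forest-like if $G_\pi$ is acyclic, tree-like if $G_\pi$ is a tree, rooted tree-like if it is tree-like and $\pi(1)=1$, path-like if $G_\pi$ is a path on $n$ vertices (a single vertex counts as a path), and smooth if $\pi$ avoids the patterns $1324$ and $2143$, that is, there are no indices $p<q<r<s$ with $\pi(p)<\pi(r)<\pi(q)<\pi(s)$ and none with $\pi(q)<\pi(p)<\pi(s)<\pi(r)$. For $n\ge 1$ let $f_n,t_n,r_n,p_n,s_n$ be the numbers of forest-like, tree-like, rooted tree-like, path-like and smooth permutations of $\{1,\dots,n\}$, respectively, and let $F(x)=\sum_{n\ge1}f_nx^n$, and similarly $T(x),R(x),P(x),S(x)$, be their generating functions. Then, as formal power series over $\mathbb{Q}$, where $\sqrt{1-4x}$ denotes the power series with square $1-4x$ and constant term $1$, $$F(x)=\frac{(1-x)(1-4x-2x^2)-(1-5x)\sqrt{1-4x}}{2(1-5x+2x^2-x^3)},$$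 $$T(x)=\frac{1-3x-6x^2-(1-5x)\sqrt{1-4x}}{2(2-9x)},$$ $$R(x)=\frac{1-\sqrt{1-4x}}{2},$$ $$P(x)=x\,\frac{1-2x+2x^2}{(1-x)(1-2x)},$$ $$S(x)=x\,\frac{1-5x+4x^2+x\sqrt{1-4x}}{1-6x+8x^2-4x^3}.$$ In particular, $r_n$ is the $(n-1)$st Catalan number $\frac1n\binom{2n-2}{n-1}$ for every $n\ge1$, and $p_n=2^{n-1}-1$ for every $n\ge2$. -/

import Mathlib

open PowerSeries

/-- `i → j` is an (ascending) edge of the diagram of `π`: `i < j`, `π i < π j`, and no `k` strictly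
between `i` and `j` has `π k` strictly between `π i` and `π j`. -/
def PermEdge {n : ℕ} (π : Equiv.Perm (Fin n)) (i j : Fin n) : Prop :=
  i < j ∧ π i < π j ∧ ¬ ∃ k : Fin n, i < k ∧ k < j ∧ π i < π k ∧ π k < π j

/-- The graph `G_π` on the vertex set `{1, …, n}` (here `Fin n`, that is `{0, …, n - 1}`). -/
def permGraph {n : ℕ} (π : Equiv.Perm (Fin n)) : SimpleGraph (Fin n) where
  Adj i j := PermEdge π i j ∨ PermEdge π j i
  symm := ⟨fun _ _ h => h.symm⟩
  loopless := ⟨fun i h => h.elim (fun h => lt_irrefl i h.1) (fun h => lt_irrefl i h.1)⟩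

/-- `π` is forest-like: `G_π` has no cycle. -/
def IsForestLike {n : ℕ} (π : Equiv.Perm (Fin n)) : Prop :=
  (permGraph π).IsAcyclic

/-- `π` is tree-like: `G_π` is a tree. -/
def IsTreeLike {n : ℕ} (π : Equiv.Perm (Fin n)) : Prop :=
  (permGraph π).IsTree

/-- `π` is rooted tree-like: tree-like, and `π` fixes the first element. -/
def IsRootedTreeLike {n : ℕ} (π : Equiv.Perm (Fin n)) : Prop :=
  IsTreeLike π ∧ ∀ i : Fin n, (i : ℕ) = 0 → (π i : ℕ) = 0

/-- `π` is path-like: `G_π` is a path, that is, isomorphic to the path on `n` vertices. -/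
def IsPathLike {n : ℕ} (π : Equiv.Perm (Fin n)) : Prop :=
  Nonempty (permGraph π ≃g SimpleGraph.pathGraph n)

/-- `π` avoids the pattern `1324`. -/
def Avoids1324 {n : ℕ} (π : Equiv.Perm (Fin n)) : Prop :=
  ¬ ∃ p q r s : Fin n, p < q ∧ q < r ∧ r < s ∧ π p < π r ∧ π r < π q ∧ π q < π s

/-- `π` avoids the pattern `2143`. -/
def Avoids2143 {n : ℕ} (π : Equiv.Perm (Fin n)) : Prop :=
  ¬ ∃ p q r s : Fin n, p < q ∧ q < r ∧ r < s ∧ π q < π p ∧ π p < π s ∧ π s < π r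

/-- `π` is smooth: it avoids `1324` and `2143`. -/
def IsSmoothPerm {n : ℕ} (π : Equiv.Perm (Fin n)) : Prop :=
  Avoids1324 π ∧ Avoids2143 π

/-- The number `f_n` of forest-like permutations of size `n`. -/
noncomputable def forestCount (n : ℕ) : ℕ :=
  Nat.card {π : Equiv.Perm (Fin n) // IsForestLike π}

/-- The number `t_n` of tree-like permutations of size `n`. -/
noncomputable def treeCount (n : ℕ) : ℕ :=
  Nat.card {π : Equiv.Perm (Fin n) // IsTreeLike π}

/-- The number `r_n` of rooted tree-like permutations of size `n`. -/
noncomputable def rootedTreeCount (n : ℕ) : ℕ :=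
  Nat.card {π : Equiv.Perm (Fin n) // IsRootedTreeLike π}

/-- The number `p_n` of path-like permutations of size `n`. -/
noncomputable def pathCount (n : ℕ) : ℕ :=
  Nat.card {π : Equiv.Perm (Fin n) // IsPathLike π}

/-- The number `s_n` of smooth permutations of size `n`. -/
noncomputable def smoothCount (n : ℕ) : ℕ :=
  Nat.card {π : Equiv.Perm (Fin n) // IsSmoothPerm π}

/-- The ordinary generating function `∑_{n ≥ 1} a n xⁿ`, as a formal power series over `ℚ`; the
sum starts at `n = 1`. -/
noncomputable def genFun (a : ℕ → ℕ) : ℚ⟦X⟧ :=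
  PowerSeries.mk fun n => if n = 0 then 0 else (a n : ℚ)

/-- The permutation obtained from `σ` by appending the value `s` in a new last position. -/
noncomputable def insLast {n : ℕ} (σ : Equiv.Perm (Fin n)) (s : Fin (n + 1)) :
    Equiv.Perm (Fin (n + 1)) :=
  Equiv.ofBijective (Fin.lastCases (motive := fun _ => Fin (n + 1)) s fun i => s.succAbove (σ i))
    (by
      rw [← Finite.injective_iff_bijective]
      intro x y
      induction x using Fin.lastCases <;> induction y using Fin.lastCases <;>
        simp [Fin.succAbove_ne, (Fin.succAbove_ne _ _).symm])

@[simp] theorem insLast_last {n : ℕ} (σ : Equiv.Perm (Fin n)) (s : Fin (n + 1)) :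
    insLast σ s (Fin.last n) = s := by simp [insLast]

@[simp] theorem insLast_castSucc {n : ℕ} (σ : Equiv.Perm (Fin n)) (s : Fin (n + 1)) (i : Fin n) :
    insLast σ s i.castSucc = s.succAbove (σ i) := by simp [insLast]

theorem insLast_castSucc_lt {n : ℕ} (σ : Equiv.Perm (Fin n)) (s : Fin (n + 1)) (i j : Fin n) :
    insLast σ s i.castSucc < insLast σ s j.castSucc ↔ σ i < σ j := by simp

theorem insLast_castSucc_lt_self {n : ℕ} (σ : Equiv.Perm (Fin n)) (s : Fin (n + 1)) (i : Fin n) :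
    insLast σ s i.castSucc < s ↔ (σ i : ℕ) < s := by
  rw [insLast_castSucc, Fin.succAbove_lt_iff_castSucc_lt, Fin.lt_def, Fin.val_castSucc]

theorem lt_insLast_castSucc {n : ℕ} (σ : Equiv.Perm (Fin n)) (s : Fin (n + 1)) (i : Fin n) :
    s < insLast σ s i.castSucc ↔ (s : ℕ) ≤ σ i := by
  rw [insLast_castSucc, Fin.lt_succAbove_iff_le_castSucc, Fin.le_def, Fin.val_castSucc]

theorem insLast_injective {n : ℕ} :
    Function.Injective fun p : Equiv.Perm (Fin n) × Fin (n + 1) => insLast p.1 p.2 := by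
  rintro ⟨σ, s⟩ ⟨σ', s'⟩ h
  have h1 : s = s' := by simpa using congrArg (fun f => f (Fin.last n)) h
  subst h1
  have h2 : σ = σ' := by
    ext1 i
    simpa using congrArg (fun f => f i.castSucc) h
  rw [h2]

theorem insLast_bijective {n : ℕ} :
    Function.Bijective fun p : Equiv.Perm (Fin n) × Fin (n + 1) => insLast p.1 p.2 := by
  rw [Fintype.bijective_iff_injective_and_card]
  refine ⟨insLast_injective, ?_⟩
  simp [Fintype.card_perm, Nat.factorial_succ, mul_comm]

theorem sum_perm_succ {M : Type*} [AddCommMonoid M] {n : ℕ} (g : Equiv.Perm (Fin (n + 1)) → M) :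
    ∑ π, g π = ∑ σ : Equiv.Perm (Fin n), ∑ s, g (insLast σ s) := by
  rw [← Fintype.sum_prod_type']
  exact (Fintype.sum_bijective _ insLast_bijective _ _ fun _ => rfl).symm

/-- The skew sum of `τ` and `ρ`: first `τ`, shifted above the values of `ρ`, then `ρ`. -/
noncomputable def skewSum {a b : ℕ} (τ : Equiv.Perm (Fin a)) (ρ : Equiv.Perm (Fin b)) :
    Equiv.Perm (Fin (a + b)) :=
  Equiv.ofBijective (Fin.addCases (motive := fun _ => Fin (a + b))
      (fun i => ⟨b + τ i, by omega⟩) fun j => ⟨ρ j, by omega⟩)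
    (by
      rw [← Finite.injective_iff_bijective]
      intro x y
      induction x using Fin.addCases with
      | left i =>
        induction y using Fin.addCases with
        | left j => simp [← Fin.ext_iff]
        | right j => simp [Fin.ext_iff]; omega
      | right i =>
        induction y using Fin.addCases with
        | left j => simp [Fin.ext_iff]; omega
        | right j => simp [← Fin.ext_iff])

@[simp] theorem skewSum_castAdd {a b : ℕ} (τ : Equiv.Perm (Fin a)) (ρ : Equiv.Perm (Fin b))
    (i : Fin a) : (skewSum τ ρ (Fin.castAdd b i) : ℕ) = b + τ i := by
  simp [skewSum]

@[simp] theorem skewSum_natAdd {a b : ℕ} (τ : Equiv.Perm (Fin a)) (ρ : Equiv.Perm (Fin b))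
    (j : Fin b) : (skewSum τ ρ (Fin.natAdd a j) : ℕ) = ρ j := by
  simp [skewSum]

theorem skewSum_inj {a b : ℕ} {τ τ' : Equiv.Perm (Fin a)} {ρ ρ' : Equiv.Perm (Fin b)} :
    skewSum τ ρ = skewSum τ' ρ' ↔ τ = τ' ∧ ρ = ρ' := by
  refine ⟨fun h => ⟨?_, ?_⟩, fun h => by rw [h.1, h.2]⟩
  · ext i
    simpa using congrArg (fun f => (f (Fin.castAdd b i) : ℕ)) h
  · ext i
    simpa using congrArg (fun f => (f (Fin.natAdd a i) : ℕ)) h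

/-- The first `a` positions carry larger values than the other ones. -/
def IsCut {n : ℕ} (σ : Equiv.Perm (Fin n)) (a : ℕ) : Prop :=
  ∀ i j : Fin n, (i : ℕ) < a → a ≤ (j : ℕ) → σ j < σ i

theorem isCut_skewSum {a b : ℕ} (τ : Equiv.Perm (Fin a)) (ρ : Equiv.Perm (Fin b)) :
    IsCut (skewSum τ ρ) a := by
  intro i j hi hj
  induction i using Fin.addCases with
  | right i => simp at hi
  | left i =>
    induction j using Fin.addCases with
    | left j => simp at hj; omega
    | right j => rw [Fin.lt_def]; simp; omega

theorem isCut_castAdd_le {a b : ℕ} {σ : Equiv.Perm (Fin (a + b))} (h : IsCut σ a) (i : Fin a) :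
    b ≤ (σ (Fin.castAdd b i) : ℕ) := by
  have h1 : (Finset.univ.image fun j : Fin b => (σ (Fin.natAdd a j) : ℕ)) ⊆
      Finset.range (σ (Fin.castAdd b i) : ℕ) := by
    intro x hx
    obtain ⟨j, -, rfl⟩ := Finset.mem_image.1 hx
    exact Finset.mem_range.2 (h _ _ (by simp) (by simp))
  have h2 := Finset.card_le_card h1
  rw [Finset.card_image_of_injective] at h2
  · simpa using h2
  · intro x y hxy
    simpa [← Fin.ext_iff] using hxy

theorem isCut_natAdd_lt {a b : ℕ} {σ : Equiv.Perm (Fin (a + b))} (h : IsCut σ a) (j : Fin b) :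
    (σ (Fin.natAdd a j) : ℕ) < b := by
  have h1 : (Finset.univ.image fun i : Fin a => (σ (Fin.castAdd b i) : ℕ)) ⊆
      Finset.Ioo (σ (Fin.natAdd a j) : ℕ) (a + b) := by
    intro x hx
    obtain ⟨i, -, rfl⟩ := Finset.mem_image.1 hx
    exact Finset.mem_Ioo.2 ⟨h _ _ (by simp) (by simp), (σ _).2⟩
  have h2 := Finset.card_le_card h1
  rw [Finset.card_image_of_injective] at h2
  · simp at h2
    omega
  · intro x y hxy
    simpa [← Fin.ext_iff] using hxy

theorem exists_skewSum_of_isCut {a b : ℕ} {σ : Equiv.Perm (Fin (a + b))} (h : IsCut σ a) :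
    ∃ (τ : Equiv.Perm (Fin a)) (ρ : Equiv.Perm (Fin b)), σ = skewSum τ ρ := by
  have h1 := isCut_castAdd_le h
  have h2 := isCut_natAdd_lt h
  refine ⟨Equiv.ofBijective
      (fun i => ⟨(σ (Fin.castAdd b i) : ℕ) - b,
        by have := (σ (Fin.castAdd b i)).2; have := i.2; omega⟩) ?_,
    Equiv.ofBijective (fun j => ⟨(σ (Fin.natAdd a j) : ℕ), h2 j⟩) ?_, ?_⟩
  · rw [← Finite.injective_iff_bijective]
    intro x y hxy
    have hx := h1 x
    have hy := h1 y
    have : (σ (Fin.castAdd b x) : ℕ) = σ (Fin.castAdd b y) := by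
      simp at hxy; omega
    simpa [← Fin.ext_iff] using this
  · rw [← Finite.injective_iff_bijective]
    intro x y hxy
    simpa [← Fin.ext_iff] using hxy
  · ext x
    induction x using Fin.addCases with
    | left i =>
      have := h1 i
      rw [skewSum_castAdd]
      change _ = b + ((σ (Fin.castAdd b i) : ℕ) - b)
      omega
    | right j => simp

/-- `σ` is nonempty and not a skew sum of two nonempty permutations. -/
def SkewIndec {n : ℕ} (σ : Equiv.Perm (Fin n)) : Prop :=
  0 < n ∧ ∀ a, 0 < a → a < n → ¬ IsCut σ a

theorem IsCut.of_skewSum {a b c : ℕ} {τ : Equiv.Perm (Fin a)} {ρ : Equiv.Perm (Fin b)}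
    (h : IsCut (skewSum τ ρ) c) : IsCut τ c := by
  intro i j hi hj
  have := h (Fin.castAdd b i) (Fin.castAdd b j) hi hj
  rw [Fin.lt_def] at this ⊢
  simpa using this

theorem IsCut.skewSum_of_le {a b c : ℕ} {τ : Equiv.Perm (Fin a)} {ρ : Equiv.Perm (Fin b)}
    (h : IsCut τ c) (hc : c ≤ a) : IsCut (skewSum τ ρ) c := by
  intro i j hi hj
  induction i using Fin.addCases with
  | right i => simp at hi; omega
  | left i =>
    induction j using Fin.addCases with
    | left j => have := h i j hi hj; rw [Fin.lt_def] at this ⊢; simpa using this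
    | right j => rw [Fin.lt_def]; simp; omega

theorem sum_perm_skewSum {M : Type*} [AddCommMonoid M] {n : ℕ} (hn : 0 < n)
    (g : ∀ n, Equiv.Perm (Fin n) → M) :
    ∑ σ : Equiv.Perm (Fin n), g n σ = ∑ p ∈ Finset.HasAntidiagonal.antidiagonal n,
      open Classical in ∑ τ : Equiv.Perm (Fin p.1), if SkewIndec τ then
        ∑ ρ : Equiv.Perm (Fin p.2), g (p.1 + p.2) (skewSum τ ρ) else 0 := by
  classical
  have key : ∀ p : ℕ × ℕ, p ∈ Finset.HasAntidiagonal.antidiagonal n →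
      (∑ τ : Equiv.Perm (Fin p.1), if SkewIndec τ then
        ∑ ρ : Equiv.Perm (Fin p.2), g (p.1 + p.2) (skewSum τ ρ) else 0) =
      ∑ σ : Equiv.Perm (Fin n), if 0 < p.1 ∧ IsCut σ p.1 ∧ ∀ c, 0 < c → c < p.1 → ¬ IsCut σ c then
        g n σ else 0 := by
    rintro ⟨a, b⟩ hp
    obtain rfl : a + b = n := by simpa using hp
    rw [← Finset.sum_filter, ← Finset.sum_filter, ← Finset.sum_product']
    refine Finset.sum_bij (fun q _ => skewSum q.1 q.2) ?_ ?_ ?_ ?_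
    · rintro ⟨τ, ρ⟩ hq
      simp only [Finset.mem_product, Finset.mem_filter, Finset.mem_univ, true_and, and_true] at hq
      simp only [Finset.mem_filter, Finset.mem_univ, true_and]
      exact ⟨hq.1, isCut_skewSum τ ρ, fun c h0 hc h => hq.2 c h0 hc h.of_skewSum⟩
    · rintro ⟨τ, ρ⟩ - ⟨τ', ρ'⟩ - h
      have := skewSum_inj.1 h
      exact Prod.ext this.1 this.2
    · intro σ hσ
      simp only [Finset.mem_filter, Finset.mem_univ, true_and] at hσ
      obtain ⟨τ, ρ, rfl⟩ := exists_skewSum_of_isCut hσ.2.1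
      refine ⟨(τ, ρ), ?_, rfl⟩
      simp only [Finset.mem_product, Finset.mem_filter, Finset.mem_univ, true_and, and_true]
      exact ⟨hσ.1, fun c h0 hc h => hσ.2.2 c h0 hc (h.skewSum_of_le hc.le)⟩
    · intros; rfl
  rw [Finset.sum_congr rfl key, Finset.sum_comm]
  refine Finset.sum_congr rfl fun σ _ => ?_
  have hex : ∃ a, 0 < a ∧ IsCut σ a := ⟨n, hn, fun i j _ hj => by omega⟩
  have hle : Nat.find hex ≤ n := Nat.find_min' hex ⟨hn, fun i j _ hj => by omega⟩
  rw [Finset.sum_eq_single (Nat.find hex, n - Nat.find hex)]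
  · rw [if_pos]
    refine ⟨(Nat.find_spec hex).1, (Nat.find_spec hex).2, fun c h0 hc h => ?_⟩
    exact Nat.find_min hex hc ⟨h0, h⟩
  · rintro ⟨a, b⟩ hp hne
    rw [if_neg]
    rintro ⟨h0, hc, hmin⟩
    apply hne
    have : Nat.find hex = a := by
      rw [Nat.find_eq_iff]
      exact ⟨⟨h0, hc⟩, fun c hc h => hmin c h.1 hc h.2⟩
    simp at hp
    simp only [Prod.mk.injEq]
    omega
  · intro h
    simp at h
    omega

/-- `i` is a maximal element, for the order underlying the diagram, among the elements whose value
is less than `s`. -/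
def IsMaxBelow {n : ℕ} (σ : Equiv.Perm (Fin n)) (s : ℕ) (i : Fin n) : Prop :=
  (σ i : ℕ) < s ∧ ∀ k, i < k → σ i < σ k → s ≤ (σ k : ℕ)

theorem permEdge_insLast_castSucc {n : ℕ} (σ : Equiv.Perm (Fin n)) (s : Fin (n + 1))
    (i j : Fin n) : PermEdge (insLast σ s) i.castSucc j.castSucc ↔ PermEdge σ i j := by
  unfold PermEdge
  rw [insLast_castSucc_lt, Fin.castSucc_lt_castSucc_iff]
  refine and_congr_right fun hij => and_congr_right fun _ => not_congr ⟨?_, ?_⟩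
  · rintro ⟨k, h1, h2, h3, h4⟩
    induction k using Fin.lastCases with
    | last => exact absurd h2 (Fin.castSucc_lt_last j).asymm
    | cast k =>
      rw [insLast_castSucc_lt] at h3 h4
      exact ⟨k, by simpa using h1, by simpa using h2, h3, h4⟩
  · rintro ⟨k, h1, h2, h3, h4⟩
    refine ⟨k.castSucc, by simpa using h1, by simpa using h2, ?_, ?_⟩ <;>
      rwa [insLast_castSucc_lt]

theorem permEdge_insLast_last {n : ℕ} (σ : Equiv.Perm (Fin n)) (s : Fin (n + 1))
    (i : Fin n) : PermEdge (insLast σ s) i.castSucc (Fin.last n) ↔ IsMaxBelow σ s i := by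
  unfold PermEdge IsMaxBelow
  rw [insLast_last, insLast_castSucc_lt_self]
  simp only [Fin.castSucc_lt_last, true_and]
  refine and_congr_right fun hi => ⟨?_, ?_⟩
  · intro h k hk hik
    by_contra hlt
    refine h ⟨k.castSucc, by simpa using hk, Fin.castSucc_lt_last k, ?_, ?_⟩
    · rwa [insLast_castSucc_lt]
    · rw [insLast_castSucc_lt_self]; omega
  · rintro h ⟨k, h1, h2, h3, h4⟩
    induction k using Fin.lastCases with
    | last => exact lt_irrefl _ h2
    | cast k =>
      rw [insLast_castSucc_lt] at h3
      rw [insLast_castSucc_lt_self] at h4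
      have := h k (by simpa using h1) h3
      omega

theorem not_permEdge_last {n : ℕ} (π : Equiv.Perm (Fin (n + 1))) (i : Fin (n + 1)) :
    ¬ PermEdge π (Fin.last n) i := fun h => absurd h.1 (Fin.le_last i).not_gt

section skewSum
variable {a b : ℕ} (τ : Equiv.Perm (Fin a)) (ρ : Equiv.Perm (Fin b))

theorem skewSum_castAdd_lt (i j : Fin a) :
    skewSum τ ρ (Fin.castAdd b i) < skewSum τ ρ (Fin.castAdd b j) ↔ τ i < τ j := by
  rw [Fin.lt_def, Fin.lt_def]; simp

theorem skewSum_natAdd_lt (i j : Fin b) :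
    skewSum τ ρ (Fin.natAdd a i) < skewSum τ ρ (Fin.natAdd a j) ↔ ρ i < ρ j := by
  rw [Fin.lt_def, Fin.lt_def]; simp

theorem skewSum_natAdd_lt_castAdd (i : Fin a) (j : Fin b) :
    skewSum τ ρ (Fin.natAdd a j) < skewSum τ ρ (Fin.castAdd b i) := by
  rw [Fin.lt_def]; simp; omega

theorem castAdd_lt_natAdd (i : Fin a) (j : Fin b) : Fin.castAdd b i < Fin.natAdd a j := by
  rw [Fin.lt_def]; simp; omega

theorem not_permEdge_skewSum_castAdd_natAdd (i : Fin a) (j : Fin b) :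
    ¬ PermEdge (skewSum τ ρ) (Fin.castAdd b i) (Fin.natAdd a j) :=
  fun h => h.2.1.asymm (skewSum_natAdd_lt_castAdd τ ρ i j)

theorem not_permEdge_skewSum_natAdd_castAdd (i : Fin a) (j : Fin b) :
    ¬ PermEdge (skewSum τ ρ) (Fin.natAdd a j) (Fin.castAdd b i) :=
  fun h => h.1.asymm (castAdd_lt_natAdd i j)

theorem permEdge_skewSum_castAdd (i j : Fin a) :
    PermEdge (skewSum τ ρ) (Fin.castAdd b i) (Fin.castAdd b j) ↔ PermEdge τ i j := by
  unfold PermEdge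
  rw [skewSum_castAdd_lt]
  refine and_congr_right fun hij => and_congr_right fun _ => not_congr ⟨?_, ?_⟩
  · rintro ⟨k, h1, h2, h3, h4⟩
    induction k using Fin.addCases with
    | left k =>
      rw [skewSum_castAdd_lt] at h3 h4
      exact ⟨k, h1, h2, h3, h4⟩
    | right k => exact absurd h2 (castAdd_lt_natAdd j k).asymm
  · rintro ⟨k, h1, h2, h3, h4⟩
    refine ⟨Fin.castAdd b k, h1, h2, ?_, ?_⟩ <;> rwa [skewSum_castAdd_lt]

theorem permEdge_skewSum_natAdd (i j : Fin b) :
    PermEdge (skewSum τ ρ) (Fin.natAdd a i) (Fin.natAdd a j) ↔ PermEdge ρ i j := by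
  unfold PermEdge
  rw [skewSum_natAdd_lt, Fin.natAdd_lt_natAdd_iff]
  refine and_congr_right fun hij => and_congr_right fun _ => not_congr ⟨?_, ?_⟩
  · rintro ⟨k, h1, h2, h3, h4⟩
    induction k using Fin.addCases with
    | left k => exact absurd h1 (castAdd_lt_natAdd k i).asymm
    | right k =>
      rw [skewSum_natAdd_lt] at h3 h4
      exact ⟨k, by simpa using h1, by simpa using h2, h3, h4⟩
  · rintro ⟨k, h1, h2, h3, h4⟩
    refine ⟨Fin.natAdd a k, by simpa using h1, by simpa using h2, ?_, ?_⟩ <;>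
      rwa [skewSum_natAdd_lt]

theorem isMaxBelow_skewSum_castAdd (t : ℕ) (i : Fin a) :
    IsMaxBelow (skewSum τ ρ) (b + t) (Fin.castAdd b i) ↔ IsMaxBelow τ t i := by
  unfold IsMaxBelow
  rw [skewSum_castAdd]
  refine and_congr (by omega) ⟨?_, ?_⟩
  · intro h k hk hik
    have := h (Fin.castAdd b k) hk (by rwa [skewSum_castAdd_lt])
    rw [skewSum_castAdd] at this
    omega
  · intro h k hk hik
    induction k using Fin.addCases with
    | left k =>
      have := h k hk (by rwa [skewSum_castAdd_lt] at hik)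
      rw [skewSum_castAdd]
      omega
    | right k => exact absurd hik (skewSum_natAdd_lt_castAdd τ ρ i k).asymm

theorem isMaxBelow_skewSum_natAdd (t : ℕ) (i : Fin b) :
    IsMaxBelow (skewSum τ ρ) (b + t) (Fin.natAdd a i) ↔ IsMaxBelow ρ b i := by
  unfold IsMaxBelow
  rw [skewSum_natAdd]
  refine and_congr (by omega) ⟨?_, ?_⟩
  · intro h k hk hik
    have := h (Fin.natAdd a k) (by simpa using hk) (by rwa [skewSum_natAdd_lt])
    rw [skewSum_natAdd] at this
    omega
  · intro h k hk hik
    induction k using Fin.addCases with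
    | left k => exact absurd hk (castAdd_lt_natAdd k i).asymm
    | right k =>
      have := h k (by simpa using hk) (by rwa [skewSum_natAdd_lt] at hik)
      omega

end skewSum

open Classical in
/-- The number of edges of the diagram. -/
noncomputable def edgeCount {n : ℕ} (π : Equiv.Perm (Fin n)) : ℕ :=
  ∑ i, ∑ j, if PermEdge π i j then 1 else 0

open Classical in
/-- The number of maximal elements among those of value less than `s`. -/
noncomputable def maxBelowCount {n : ℕ} (σ : Equiv.Perm (Fin n)) (s : ℕ) : ℕ :=
  ∑ i, if IsMaxBelow σ s i then 1 else 0

theorem edgeCount_insLast {n : ℕ} (σ : Equiv.Perm (Fin n)) (s : Fin (n + 1)) :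
    edgeCount (insLast σ s) = edgeCount σ + maxBelowCount σ s := by
  classical
  simp only [edgeCount, maxBelowCount, Fin.sum_univ_castSucc, permEdge_insLast_castSucc,
    permEdge_insLast_last, not_permEdge_last, Finset.sum_add_distrib]
  simp

theorem edgeCount_skewSum {a b : ℕ} (τ : Equiv.Perm (Fin a)) (ρ : Equiv.Perm (Fin b)) :
    edgeCount (skewSum τ ρ) = edgeCount τ + edgeCount ρ := by
  classical
  simp only [edgeCount, Fin.sum_univ_add, permEdge_skewSum_castAdd, permEdge_skewSum_natAdd,
    not_permEdge_skewSum_castAdd_natAdd, not_permEdge_skewSum_natAdd_castAdd]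
  simp

theorem maxBelowCount_skewSum {a b : ℕ} (τ : Equiv.Perm (Fin a)) (ρ : Equiv.Perm (Fin b)) (t : ℕ) :
    maxBelowCount (skewSum τ ρ) (b + t) = maxBelowCount τ t + maxBelowCount ρ b := by
  classical
  simp only [maxBelowCount, Fin.sum_univ_add, isMaxBelow_skewSum_castAdd,
    isMaxBelow_skewSum_natAdd]

theorem PermEdge.not_symm {n : ℕ} {π : Equiv.Perm (Fin n)} {i j : Fin n} (h : PermEdge π i j) :
    ¬ PermEdge π j i := fun h' => h.1.asymm h'.1

theorem card_edgeSet_permGraph {n : ℕ} (π : Equiv.Perm (Fin n)) :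
    Nat.card (permGraph π).edgeSet = edgeCount π := by
  classical
  have h1 := (permGraph π).sum_degrees_eq_twice_card_edges
  have h2 : ∀ i, (permGraph π).degree i =
      (∑ j, if PermEdge π i j then 1 else 0) + ∑ j, if PermEdge π j i then 1 else 0 := by
    intro i
    rw [← SimpleGraph.card_neighborFinset_eq_degree, SimpleGraph.neighborFinset_eq_filter,
      Finset.card_filter, ← Finset.sum_add_distrib]
    refine Finset.sum_congr rfl fun j _ => ?_
    have hadj : (permGraph π).Adj i j ↔ PermEdge π i j ∨ PermEdge π j i := Iff.rfl
    rw [if_congr hadj rfl rfl]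
    by_cases h : PermEdge π i j
    · simp [h, h.not_symm]
    · simp [h]
  simp only [h2, Finset.sum_add_distrib] at h1
  rw [Finset.sum_comm (f := fun i j => if PermEdge π j i then 1 else 0)] at h1
  rw [Nat.card_eq_fintype_card, ← SimpleGraph.edgeFinset_card]
  unfold edgeCount
  omega

theorem permGraph_reachable_of_lt {n : ℕ} (π : Equiv.Perm (Fin n)) {i j : Fin n} (hij : i < j)
    (hπ : π i < π j) : (permGraph π).Reachable i j := by
  by_cases h : ∃ k : Fin n, i < k ∧ k < j ∧ π i < π k ∧ π k < π j
  · obtain ⟨k, h1, h2, h3, h4⟩ := h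
    exact (permGraph_reachable_of_lt π h1 h3).trans (permGraph_reachable_of_lt π h2 h4)
  · exact SimpleGraph.Adj.reachable (Or.inl ⟨hij, hπ, h⟩)
termination_by (j : ℕ) - i

theorem permGraph_adj_lt {n : ℕ} {π : Equiv.Perm (Fin n)} {i j : Fin n}
    (h : (permGraph π).Adj i j) : (i < j ∧ π i < π j) ∨ (j < i ∧ π j < π i) :=
  h.imp (fun h => ⟨h.1, h.2.1⟩) fun h => ⟨h.1, h.2.1⟩

theorem permGraph_connected_iff {n : ℕ} (π : Equiv.Perm (Fin n)) :
    (permGraph π).Connected ↔ SkewIndec π := by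
  constructor
  · intro h
    obtain ⟨v⟩ := h.nonempty
    refine ⟨v.pos, fun a ha han hcut => ?_⟩
    have key : ∀ w, (permGraph π).Reachable ⟨0, v.pos⟩ w → (w : ℕ) < a := by
      intro w hw
      rw [SimpleGraph.reachable_iff_reflTransGen] at hw
      induction hw with
      | refl => exact ha
      | tail _ hadj ih =>
        rename_i x y _
        by_contra hy
        have hxy := hcut _ _ ih (not_lt.1 hy)
        rcases permGraph_adj_lt hadj with h | h
        · exact h.2.asymm hxy
        · have := h.1; rw [Fin.lt_def] at this; omega
    exact (key ⟨a, han⟩ (h.preconnected _ _)).false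
  · rintro ⟨hn, hcut⟩
    have key : ∀ w, (permGraph π).Reachable ⟨0, hn⟩ w := by
      by_contra! hex
      classical
      have hfin : (Finset.univ.filter fun w => ¬ (permGraph π).Reachable ⟨0, hn⟩ w).Nonempty := by
        obtain ⟨w, hw⟩ := hex
        exact ⟨w, by simpa using hw⟩
      set j := (Finset.univ.filter fun w => ¬ (permGraph π).Reachable ⟨0, hn⟩ w).min' hfin with hj
      have hjm : ¬ (permGraph π).Reachable ⟨0, hn⟩ j := by
        simpa using Finset.min'_mem _ hfin
      have hmin : ∀ w, w < j → (permGraph π).Reachable ⟨0, hn⟩ w := by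
        intro w hw
        by_contra h
        exact (Finset.min'_le _ w (by simpa using h)).not_gt hw
      have hlow : ∀ w, w < j → π j < π w := by
        intro w hw
        by_contra h
        have h' : π w < π j := lt_of_le_of_ne (not_lt.1 h) fun e => hw.ne (π.injective e)
        exact hjm ((hmin w hw).trans (permGraph_reachable_of_lt π hw h'))
      have hhigh : ∀ w, j < w → (permGraph π).Reachable ⟨0, hn⟩ w → π w < π j := by
        intro w hw hr
        by_contra h
        have h' : π j < π w := lt_of_le_of_ne (not_lt.1 h) fun e => hw.ne (π.injective e)
        exact hjm (hr.trans (permGraph_reachable_of_lt π hw h').symm)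
      have h0 : (⟨0, hn⟩ : Fin n) < j := by
        rw [Fin.lt_def]
        by_contra h
        apply hjm
        rw [show j = ⟨0, hn⟩ from Fin.ext (by simpa using h)]
      have hside : ∀ w, (permGraph π).Reachable ⟨0, hn⟩ w → w < j := by
        intro w hw
        have hw' := hw
        rw [SimpleGraph.reachable_iff_reflTransGen] at hw
        induction hw with
        | refl => exact h0
        | tail hx hadj ih =>
          rename_i x y
          rw [← SimpleGraph.reachable_iff_reflTransGen] at hx
          have hxj := ih hx
          rcases lt_trichotomy y j with h | h | h
          · exact h
          · exact absurd (h ▸ hw') hjm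
          · exfalso
            have h1 := (hhigh y h hw').trans (hlow x hxj)
            rcases permGraph_adj_lt hadj with h2 | h2
            · exact h2.2.asymm h1
            · exact absurd h2.1 (hxj.trans h).asymm
      refine hcut j h0 j.2 fun x y hx hy => ?_
      by_contra h
      have hxy : x < y := Fin.lt_def.2 (lt_of_lt_of_le hx hy)
      have h' : π x < π y := lt_of_le_of_ne (not_lt.1 h) fun e => hxy.ne (π.injective e)
      have := hside y ((hmin x (Fin.lt_def.2 hx)).trans (permGraph_reachable_of_lt π hxy h'))
      rw [Fin.lt_def] at this
      omega
    have : Nonempty (Fin n) := ⟨⟨0, hn⟩⟩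
    exact ⟨fun x y => (key x).symm.trans (key y)⟩

theorem SkewIndec.le_edgeCount {n : ℕ} {π : Equiv.Perm (Fin n)} (h : SkewIndec π) :
    n ≤ edgeCount π + 1 := by
  have := ((permGraph_connected_iff π).2 h).card_vert_le_card_edgeSet_add_one
  rwa [card_edgeSet_permGraph, Nat.card_eq_fintype_card, Fintype.card_fin] at this

theorem isTreeLike_iff {n : ℕ} (π : Equiv.Perm (Fin n)) :
    IsTreeLike π ↔ SkewIndec π ∧ edgeCount π + 1 = n := by
  rw [IsTreeLike, SimpleGraph.isTree_iff_connected_and_card, permGraph_connected_iff,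
    card_edgeSet_permGraph, Nat.card_eq_fintype_card, Fintype.card_fin]

section Evaluation
open Finset

/-- The series `∑ Xⁿ Wₙ` attached to a sequence of power series. -/
noncomputable def diagSum (W : ℕ → ℚ⟦X⟧) : ℚ⟦X⟧ :=
  PowerSeries.mk fun n => ∑ m ∈ range (n + 1), coeff (n - m) (W m)

theorem X_pow_dvd_diagSum_sub (W : ℕ → ℚ⟦X⟧) (N : ℕ) :
    X ^ N ∣ diagSum W - ∑ m ∈ range N, X ^ m * W m := by
  rw [X_pow_dvd_iff]
  intro n hn
  rw [map_sub, map_sum, diagSum, coeff_mk, sub_eq_zero]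
  have hsub : range (n + 1) ⊆ range N := range_subset_range.2 hn
  rw [← sum_subset hsub (f := fun m => coeff n (X ^ m * W m))]
  · refine sum_congr rfl fun m hm => ?_
    rw [coeff_X_pow_mul', if_pos (by simpa [Nat.lt_succ_iff] using hm)]
  · intro m _ hm
    rw [coeff_X_pow_mul', if_neg (by simpa [Nat.lt_succ_iff] using hm)]

theorem eq_of_X_pow_dvd_sub {f g : ℚ⟦X⟧} (h : ∀ N, X ^ N ∣ f - g) : f = g := by
  rw [← sub_eq_zero]
  ext n
  exact X_pow_dvd_iff.1 (h (n + 1)) n (Nat.lt_succ_self n)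

theorem eq_diagSum {Z : ℚ⟦X⟧} {W : ℕ → ℚ⟦X⟧}
    (h : ∀ N, X ^ N ∣ Z - ∑ m ∈ range N, X ^ m * W m) : Z = diagSum W := by
  refine eq_of_X_pow_dvd_sub fun N => ?_
  have := dvd_sub (h N) (X_pow_dvd_diagSum_sub W N)
  rwa [sub_sub_sub_cancel_right] at this

theorem diagSum_add (V W : ℕ → ℚ⟦X⟧) :
    diagSum (fun n => V n + W n) = diagSum V + diagSum W := by
  symm
  refine eq_diagSum fun N => ?_
  have := dvd_add (X_pow_dvd_diagSum_sub V N) (X_pow_dvd_diagSum_sub W N)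
  simp only [mul_add, sum_add_distrib]
  convert this using 1
  ring

theorem diagSum_const_mul (c : ℚ⟦X⟧) (W : ℕ → ℚ⟦X⟧) :
    diagSum (fun n => c * W n) = c * diagSum W := by
  symm
  refine eq_diagSum fun N => ?_
  have := (X_pow_dvd_diagSum_sub W N).mul_left c
  convert this using 1
  rw [mul_sub, mul_sum]
  congr 1
  exact sum_congr rfl fun _ _ => by ring

theorem diagSum_sub (V W : ℕ → ℚ⟦X⟧) :
    diagSum (fun n => V n - W n) = diagSum V - diagSum W := by
  have := diagSum_add V fun n => (-1) * W n
  rw [diagSum_const_mul] at this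
  simpa [sub_eq_add_neg] using this

theorem diagSum_single (c : ℚ⟦X⟧) : diagSum (fun n => if n = 1 then c else 0) = X * c := by
  symm
  refine eq_diagSum fun N => ?_
  simp only [mul_ite, mul_zero, sum_ite_eq', mem_range]
  split_ifs with h
  · simp
  · have : N ≤ 1 := by omega
    rw [sub_zero]
    exact ((pow_dvd_pow X this).trans (by rw [pow_one])).mul_right c

theorem diagSum_shift (W : ℕ → ℚ⟦X⟧) :
    diagSum (fun n => if n = 0 then 0 else W (n - 1)) = X * diagSum W := by
  symm
  refine eq_diagSum fun N => ?_
  rcases N with _ | N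
  · simp
  rw [sum_range_succ']
  simp only [Nat.succ_ne_zero, if_false, if_true, Nat.add_sub_cancel, mul_zero, add_zero]
  have := mul_dvd_mul_left X (X_pow_dvd_diagSum_sub W N)
  rw [← pow_succ'] at this
  convert this using 1
  rw [mul_sub, mul_sum]
  congr 1
  exact sum_congr rfl fun _ _ => by ring

theorem diagSum_mul (V W : ℕ → ℚ⟦X⟧) :
    diagSum (fun n => ∑ p ∈ antidiagonal n, V p.1 * W p.2) = diagSum V * diagSum W := by
  symm
  refine eq_diagSum fun N => ?_
  have h1 : X ^ N ∣ diagSum V * diagSum W -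
      (∑ m ∈ range N, X ^ m * V m) * ∑ m ∈ range N, X ^ m * W m := by
    have := dvd_add ((X_pow_dvd_diagSum_sub V N).mul_right (diagSum W))
      ((X_pow_dvd_diagSum_sub W N).mul_left (∑ m ∈ range N, X ^ m * V m))
    convert this using 1
    ring
  have h2 : X ^ N ∣ (∑ m ∈ range N, X ^ m * V m) * (∑ m ∈ range N, X ^ m * W m) -
      ∑ n ∈ range N, X ^ n * ∑ p ∈ antidiagonal n, V p.1 * W p.2 := by
    rw [sum_mul_sum, ← sum_product', ← sum_filter_add_sum_filter_not _ fun p => p.1 + p.2 < N]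
    have h3 : ∑ n ∈ range N, X ^ n * ∑ p ∈ antidiagonal n, V p.1 * W p.2 =
        ∑ p ∈ range N ×ˢ range N with p.1 + p.2 < N, X ^ p.1 * V p.1 * (X ^ p.2 * W p.2) := by
      rw [← sum_fiberwise_of_maps_to (s := filter (fun p => p.1 + p.2 < N) (range N ×ˢ range N))
        (t := range N) (g := fun p => p.1 + p.2) (by simp)]
      refine sum_congr rfl fun n hn => ?_
      rw [mul_sum]
      refine sum_congr ?_ ?_
      · ext ⟨a, b⟩
        simp at hn ⊢
        omega
      · rintro ⟨a, b⟩ h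
        simp at h
        rw [← h.2]
        ring
    rw [h3, add_sub_cancel_left]
    refine dvd_sum fun p hp => ?_
    simp at hp
    have : X ^ p.1 * V p.1 * (X ^ p.2 * W p.2) = X ^ (p.1 + p.2) * (V p.1 * W p.2) := by ring
    rw [this]
    exact (pow_dvd_pow X hp.2).mul_right _
  have := dvd_add h1 h2
  rwa [sub_add_sub_cancel] at this

theorem diagSum_natCast (a : ℕ → ℕ) (h : a 0 = 0) :
    diagSum (fun n => (a n : ℚ⟦X⟧)) = genFun a := by
  ext n
  have hc : ∀ k m : ℕ, coeff k (m : ℚ⟦X⟧) = if k = 0 then (m : ℚ) else 0 := by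
    intro k m
    rw [← map_natCast (C (R := ℚ)), coeff_C]
  rw [diagSum, genFun, coeff_mk, coeff_mk, sum_eq_single n]
  · rw [hc, Nat.sub_self, if_pos rfl]
    split_ifs with h0
    · simp [h0, h]
    · rfl
  · intro m hm hne
    rw [hc, if_neg]
    simp at hm
    omega
  · simp

end Evaluation

open Classical in
/-- `x` if `p` holds, and `0` otherwise. -/
noncomputable def indic {M : Type*} [Zero M] (p : Prop) (x : M) : M := if p then x else 0

section indic
variable {M : Type*} [Zero M] {p q : Prop} {x y : M}

theorem indic_pos (h : p) : indic p x = x := if_pos h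
theorem indic_neg (h : ¬ p) : indic p x = 0 := if_neg h
theorem indic_and : indic (p ∧ q) x = indic p (indic q x) := by
  by_cases hp : p <;> by_cases hq : q <;> simp [indic, hp, hq]
theorem indic_congr (h : p ↔ q) (hxy : q → x = y) : indic p x = indic q y := by
  by_cases hq : q
  · rw [indic_pos hq, indic_pos (h.2 hq), hxy hq]
  · rw [indic_neg hq, indic_neg fun hp => hq (h.1 hp)]
theorem indic_congr_right (h : p → x = y) : indic p x = indic p y := indic_congr Iff.rfl h
end indic

theorem indic_mul {R : Type*} [MulZeroClass R] {p : Prop} {x y : R} :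
    indic p x * y = indic p (x * y) := by
  by_cases hp : p <;> simp [indic, hp]

theorem mul_indic {R : Type*} [MulZeroClass R] {p : Prop} {x y : R} :
    y * indic p x = indic p (y * x) := by
  by_cases hp : p <;> simp [indic, hp]

theorem indic_sum {ι M : Type*} [AddCommMonoid M] {p : Prop} {s : Finset ι} {f : ι → M} :
    indic p (∑ i ∈ s, f i) = ∑ i ∈ s, indic p (f i) := by
  by_cases hp : p <;> simp [indic, hp]

/-- The last position carries the largest value. -/
def IsTopped {n : ℕ} (π : Equiv.Perm (Fin n)) : Prop :=
  ∀ i : Fin n, (i : ℕ) + 1 = n → (π i : ℕ) + 1 = n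

theorem isTopped_insLast {n : ℕ} (σ : Equiv.Perm (Fin n)) (s : Fin (n + 1)) :
    IsTopped (insLast σ s) ↔ s = Fin.last n := by
  constructor
  · intro h
    have := h (Fin.last n) (by simp)
    rw [insLast_last] at this
    exact Fin.ext (by simpa using this)
  · rintro rfl i hi
    rw [show i = Fin.last n from Fin.ext (by simpa using hi), insLast_last]
    simp

theorem sum_indic_isTopped {M : Type*} [AddCommMonoid M] {n : ℕ}
    (h : Equiv.Perm (Fin (n + 1)) → M) :
    ∑ β, indic (IsTopped β) (h β) = ∑ ρ : Equiv.Perm (Fin n), h (insLast ρ (Fin.last n)) := by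
  rw [sum_perm_succ]
  refine Finset.sum_congr rfl fun ρ _ => ?_
  rw [Finset.sum_eq_single (Fin.last n)]
  · rw [indic_pos ((isTopped_insLast _ _).2 rfl)]
  · intro s _ hs
    rw [indic_neg fun h => hs ((isTopped_insLast _ _).1 h)]
  · simp

/-- The result of appending, to the skew sum of `τ` and `ρ`, a last element whose value is just
above the one that comes from the position `e` of `τ`. -/
noncomputable def glue {a b : ℕ} (τ : Equiv.Perm (Fin a)) (e : Fin a) (ρ : Equiv.Perm (Fin b)) :
    Equiv.Perm (Fin (a + b + 1)) :=
  insLast (skewSum τ ρ) ⟨b + (τ e + 1), by omega⟩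

theorem skewSum_zero {a : ℕ} (τ : Equiv.Perm (Fin a)) (ρ : Equiv.Perm (Fin 0)) :
    (skewSum τ ρ : Equiv.Perm (Fin a)) = τ := by
  ext i
  have := skewSum_castAdd τ ρ i
  rw [zero_add] at this
  exact this

theorem glue_zero {a : ℕ} (τ : Equiv.Perm (Fin a)) (e : Fin a) (ρ : Equiv.Perm (Fin 0)) :
    (glue τ e ρ : Equiv.Perm (Fin (a + 1))) = insLast τ (τ e).succ := by
  have : (⟨0 + (τ e + 1), by omega⟩ : Fin (a + 1)) = (τ e).succ := Fin.ext (by simp)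
  rw [← this]
  exact congrArg (fun σ : Equiv.Perm (Fin a) => insLast σ ⟨0 + (τ e + 1), by omega⟩)
    (skewSum_zero τ ρ)

theorem isCut_insLast_skewSum {a b : ℕ} (τ : Equiv.Perm (Fin a)) (ρ : Equiv.Perm (Fin b))
    (s : Fin (a + b + 1)) (hs : (s : ℕ) ≤ b) : IsCut (insLast (skewSum τ ρ) s) a := by
  intro i j hi hj
  induction i using Fin.lastCases with
  | last => simp at hi
  | cast i =>
    induction j using Fin.lastCases with
    | last =>
      rw [insLast_last, lt_insLast_castSucc]
      have := isCut_castAdd_le (isCut_skewSum τ ρ) ⟨i, hi⟩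
      exact hs.trans this
    | cast j =>
      rw [insLast_castSucc_lt]
      exact isCut_skewSum τ ρ i j hi hj

/-- A class `K` of indecomposable permutations in which glueing `ρ` to the element `e` of `τ` stays
in the class exactly when `τ` is in the class, `e` is one of the sites singled out by `A`, and `ρ`
with a maximum appended satisfies `Q`. -/
structure GlueClass (K : ∀ n, Equiv.Perm (Fin n) → Prop)
    (A : ∀ n, Equiv.Perm (Fin n) → Fin n → Prop) (Q : ∀ n, Equiv.Perm (Fin n) → Prop) : Prop where
  indec : ∀ n π, K n π → SkewIndec π
  one : ∀ π, K 1 π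
  top_one : ∀ π, Q 1 π
  top_zero : ∀ π, ¬ Q 0 π
  glue_iff : ∀ a b τ e ρ, SkewIndec τ →
    (K (a + b + 1) (glue τ e ρ) ↔ K a τ ∧ A a τ e ∧ Q (b + 1) (insLast ρ (Fin.last b)))

/-- The sum of the weights `w` of the permutations of size `n` in the class `K`. -/
noncomputable def weightSum (K : ∀ n, Equiv.Perm (Fin n) → Prop)
    (w : ∀ n, Equiv.Perm (Fin n) → ℚ⟦X⟧) (n : ℕ) : ℚ⟦X⟧ :=
  ∑ π, indic (K n π) (w n π)

/-- The sum of the weights `f` of the permutations of size `n` in the class `K` with a marked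
site in `A`. -/
noncomputable def siteSum (K : ∀ n, Equiv.Perm (Fin n) → Prop)
    (A : ∀ n, Equiv.Perm (Fin n) → Fin n → Prop)
    (f : ∀ n, Equiv.Perm (Fin n) → Fin n → ℚ⟦X⟧) : ℕ → ℚ⟦X⟧ :=
  weightSum K fun n τ => ∑ e, indic (A n τ e) (f n τ e)

namespace GlueClass
variable {K : ∀ n, Equiv.Perm (Fin n) → Prop} {A : ∀ n, Equiv.Perm (Fin n) → Fin n → Prop}
  {Q : ∀ n, Equiv.Perm (Fin n) → Prop}

theorem not_zero (h : GlueClass K A Q) (π : Equiv.Perm (Fin 0)) : ¬ K 0 π :=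
  fun hπ => (h.indec 0 π hπ).1.false

theorem weightSum_zero (h : GlueClass K A Q) (w : ∀ n, Equiv.Perm (Fin n) → ℚ⟦X⟧) :
    weightSum K w 0 = 0 :=
  Finset.sum_eq_zero fun π _ => indic_neg (h.not_zero π)

theorem weightSum_succ (h : GlueClass K A Q) (w : ∀ n, Equiv.Perm (Fin n) → ℚ⟦X⟧) {n : ℕ}
    (hn : 0 < n) : weightSum K w (n + 1) = ∑ p ∈ Finset.HasAntidiagonal.antidiagonal n,
      ∑ τ : Equiv.Perm (Fin p.1), indic (K p.1 τ) (∑ e, indic (A p.1 τ e)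
        (∑ ρ : Equiv.Perm (Fin p.2), indic (Q (p.2 + 1) (insLast ρ (Fin.last p.2)))
          (w (p.1 + p.2 + 1) (glue τ e ρ)))) := by
  rw [weightSum, sum_perm_succ, sum_perm_skewSum (M := ℚ⟦X⟧) hn
    fun n σ => ∑ s, indic (K (n + 1) (insLast σ s)) (w (n + 1) (insLast σ s))]
  refine Finset.sum_congr rfl fun p _ => Finset.sum_congr rfl fun τ _ => ?_
  obtain ⟨a, b⟩ := p
  change indic _ _ = _
  by_cases hτ : SkewIndec τ
  swap
  · rw [indic_neg hτ, indic_neg fun hk => hτ (h.indec _ _ hk)]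
  rw [indic_pos hτ, indic_sum]
  simp only [indic_sum]
  refine Eq.trans (Finset.sum_congr rfl fun ρ _ => ?_) Finset.sum_comm
  symm
  refine Finset.sum_of_injOn (fun e : Fin a => (⟨b + (τ e + 1), by omega⟩ : Fin (a + b + 1)))
    ?_ (by simp) ?_ ?_
  · intro x _ y _ hxy
    simpa [← Fin.ext_iff] using hxy
  · intro s _ hs
    refine indic_neg fun hk => ?_
    rcases le_or_gt (s : ℕ) b with hsb | hsb
    · have hpos := hτ.1
      exact (h.indec _ _ hk).2 a hpos (by omega) (isCut_insLast_skewSum τ ρ s hsb)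
    · apply hs
      refine ⟨τ.symm ⟨s - b - 1, by omega⟩, by simp, ?_⟩
      ext
      simp
      omega
  · intro e _
    rw [← indic_and, ← indic_and]
    exact indic_congr (by rw [and_assoc]; exact (h.glue_iff a b τ e ρ hτ).symm) fun _ => rfl

theorem diagSum_weightSum (h : GlueClass K A Q) (w g : ∀ n, Equiv.Perm (Fin n) → ℚ⟦X⟧)
    (f : ∀ n, Equiv.Perm (Fin n) → Fin n → ℚ⟦X⟧)
    (hf : ∀ a τ e, K a τ → A a τ e → w (a + 1) (insLast τ (τ e).succ) = f a τ e)
    (hg : ∀ a b τ e ρ, 0 < b → K a τ → A a τ e → Q (b + 1) (insLast ρ (Fin.last b)) →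
      w (a + b + 1) (glue τ e ρ) = g (b + 1) (insLast ρ (Fin.last b))) :
    diagSum (weightSum K w) = X * w 1 1 + X * diagSum (siteSum K A f) +
      diagSum (siteSum K A fun _ _ _ => 1) *
        (diagSum (weightSum (fun n π => Q n π ∧ IsTopped π) g) - X * g 1 1) := by
  set V : ℕ → ℚ⟦X⟧ := weightSum (fun n π => Q n π ∧ IsTopped π) g with hV
  have hVsucc : ∀ b, V (b + 1) = ∑ ρ : Equiv.Perm (Fin b),
      indic (Q (b + 1) (insLast ρ (Fin.last b))) (g (b + 1) (insLast ρ (Fin.last b))) := by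
    intro b
    rw [hV, weightSum]
    rw [← sum_indic_isTopped (M := ℚ⟦X⟧) fun β => indic (Q (b + 1) β) (g (b + 1) β)]
    refine Finset.sum_congr rfl fun β _ => ?_
    rw [← indic_and, and_comm]
  have hV1 : V 1 = g 1 1 := by
    rw [hVsucc, Fintype.sum_unique, indic_pos (h.top_one _)]
    exact congrArg (g 1) (Subsingleton.elim (α := Equiv.Perm (Fin 1)) _ _)
  have hK1 : weightSum K w 1 = w 1 1 := by
    rw [weightSum, Fintype.sum_unique, indic_pos (h.one _), Subsingleton.elim default 1]
  have hM0 : siteSum K A (fun _ _ _ => 1) 0 = 0 := h.weightSum_zero _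
  have hY0 : siteSum K A f 0 = 0 := h.weightSum_zero _
  have hseq : weightSum K w = fun n => ((if n = 1 then w 1 1 else 0) +
      (if n = 0 then 0 else siteSum K A f (n - 1))) +
      ∑ p ∈ Finset.HasAntidiagonal.antidiagonal n, siteSum K A (fun _ _ _ => 1) p.1 *
        (if p.2 = 0 then 0 else V p.2 - if p.2 = 1 then g 1 1 else 0) := by
    funext n
    match n with
    | 0 => simp [h.weightSum_zero]
    | 1 =>
      rw [Finset.Nat.antidiagonal_succ']
      simp [hK1, hM0, hY0]
    | n + 2 =>
      rw [h.weightSum_succ w (Nat.succ_pos n), Finset.Nat.sum_antidiagonal_succ',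
        Finset.Nat.sum_antidiagonal_succ' (n := n + 1), Finset.Nat.sum_antidiagonal_succ']
      simp only [Nat.succ_ne_zero, if_false, if_true]
      have e1 : n + 2 ≠ 1 := by omega
      have e2 : n + 2 - 1 = n + 1 := rfl
      have e3 : V (0 + 1) = g 1 1 := hV1
      rw [if_neg e1, e2, e3, sub_self, mul_zero, mul_zero]
      refine congrArg₂ (· + ·) ?_ (Eq.trans ?_ ((zero_add _).symm.trans (zero_add _).symm)) |>.trans
        (congrArg₂ (· + ·) (zero_add _).symm rfl)
      · refine Finset.sum_congr rfl fun τ _ => indic_congr_right fun hτ => ?_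
        refine Finset.sum_congr rfl fun e _ => indic_congr_right fun he => ?_
        rw [Fintype.sum_unique, indic_pos (h.top_one _), ← hf _ τ e hτ he]
        exact congrArg _ (glue_zero τ e _)
      · refine Finset.sum_congr rfl fun p _ => ?_
        obtain ⟨a, b⟩ := p
        rw [siteSum, weightSum, Finset.sum_mul]
        refine Finset.sum_congr rfl fun τ _ => ?_
        rw [indic_mul]
        refine indic_congr_right fun hτ => ?_
        rw [Finset.sum_mul]
        refine Finset.sum_congr rfl fun e _ => ?_
        rw [indic_mul]
        refine indic_congr_right fun he => ?_
        rw [if_neg (by omega), sub_zero, one_mul, hVsucc]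
        refine Finset.sum_congr rfl fun ρ _ => indic_congr_right fun hρ => ?_
        exact hg a (b + 1) τ e ρ (Nat.succ_pos b) hτ he hρ
  have hV0 : (fun n => if n = 0 then 0 else V n - if n = 1 then g 1 1 else 0) =
      fun n => V n - if n = 1 then g 1 1 else 0 := by
    funext n
    split_ifs with h0 h1 h1
    · omega
    · subst h0
      rw [sub_zero, hV, weightSum, Finset.sum_eq_zero]
      exact fun π _ => indic_neg fun hπ => h.top_zero π hπ.1
    · rfl
    · rfl
  conv_lhs => rw [hseq]
  rw [diagSum_add, diagSum_add, diagSum_single, diagSum_shift,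
    diagSum_mul (siteSum K A fun _ _ _ => 1)
      fun n => if n = 0 then 0 else V n - if n = 1 then g 1 1 else 0,
    hV0, diagSum_sub, diagSum_single]

end GlueClass

/-- `e` is a right-to-left minimum of `σ`. -/
def IsRLMin {n : ℕ} (σ : Equiv.Perm (Fin n)) (e : Fin n) : Prop := ∀ q, e < q → σ e < σ q

theorem IsRLMin.le_of_lt {n : ℕ} {σ : Equiv.Perm (Fin n)} {e p : Fin n} (h : IsRLMin σ e)
    (hp : σ p ≤ σ e) : p ≤ e := not_lt.1 fun hlt => (h p hlt).not_ge hp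

theorem IsRLMin.isTopped {n : ℕ} {σ : Equiv.Perm (Fin n)} {e : Fin n} (h : IsRLMin σ e)
    (he : (σ e : ℕ) + 1 = n) : IsTopped σ := by
  intro i hi
  have h1 : i ≤ e := h.le_of_lt (by rw [Fin.le_def]; omega)
  have h2 : i = e := by rw [Fin.le_def] at h1; ext; omega
  rw [h2, he]

theorem isTopped_glue {a b : ℕ} (τ : Equiv.Perm (Fin a)) (e : Fin a) (ρ : Equiv.Perm (Fin b)) :
    IsTopped (glue τ e ρ) ↔ (τ e : ℕ) + 1 = a := by
  rw [glue, isTopped_insLast, Fin.ext_iff]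
  simp
  omega

theorem GlueClass.topped {K : ∀ n, Equiv.Perm (Fin n) → Prop}
    {A : ∀ n, Equiv.Perm (Fin n) → Fin n → Prop} {Q : ∀ n, Equiv.Perm (Fin n) → Prop}
    (h : GlueClass K A Q) (hA : ∀ n τ e, A n τ e → IsRLMin τ e) :
    GlueClass (fun n π => K n π ∧ IsTopped π) (fun n τ e => A n τ e ∧ (τ e : ℕ) + 1 = n) Q where
  indec n π hπ := h.indec n π hπ.1
  one π := ⟨h.one π, fun i _ => by omega⟩
  top_one := h.top_one
  top_zero := h.top_zero
  glue_iff a b τ e ρ hτ := by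
    rw [isTopped_glue, h.glue_iff a b τ e ρ hτ]
    constructor
    · rintro ⟨⟨h1, h2, h3⟩, h4⟩
      exact ⟨⟨h1, (hA a τ e h2).isTopped h4⟩, ⟨h2, h4⟩, h3⟩
    · rintro ⟨⟨h1, -⟩, ⟨h2, h4⟩, h3⟩
      exact ⟨⟨h1, h2, h3⟩, h4⟩

theorem GlueClass.siteSum_topped {K : ∀ n, Equiv.Perm (Fin n) → Prop}
    {A : ∀ n, Equiv.Perm (Fin n) → Fin n → Prop} {Q : ∀ n, Equiv.Perm (Fin n) → Prop}
    (h : GlueClass K A Q) (f : ∀ n, Equiv.Perm (Fin n) → Fin n → ℚ⟦X⟧)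
    (w : ∀ n, Equiv.Perm (Fin n) → ℚ⟦X⟧)
    (hA : ∀ n (τ : Equiv.Perm (Fin (n + 1))), K (n + 1) τ → IsTopped τ →
      A (n + 1) τ (Fin.last n) ∧ f (n + 1) τ (Fin.last n) = w (n + 1) τ) :
    siteSum (fun n π => K n π ∧ IsTopped π) (fun n τ e => A n τ e ∧ (τ e : ℕ) + 1 = n) f =
      weightSum (fun n π => K n π ∧ IsTopped π) w := by
  funext n
  refine Finset.sum_congr rfl fun τ _ => indic_congr_right fun hτ => ?_
  have hn := (h.indec n τ hτ.1).1
  obtain ⟨m, rfl⟩ := Nat.exists_eq_add_of_le' hn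
  have hlast : τ (Fin.last m) = Fin.last m :=
    Fin.ext (by simpa using hτ.2 (Fin.last m) (by simp))
  obtain ⟨h1, h2⟩ := hA m τ hτ.1 hτ.2
  refine (Finset.sum_eq_single (Fin.last m) ?_ ?_).trans ?_
  rotate_left 2
  · rw [indic_pos, h2]
    exact ⟨h1, by rw [hlast]; simp⟩
  · intro e _ he
    refine indic_neg fun h' => he (τ.injective ?_)
    rw [hlast]
    exact Fin.ext (by simpa using h'.2)
  · simp

/-- A permutation class is counted by the weights equal to `1`. -/
theorem weightSum_one (K : ∀ n, Equiv.Perm (Fin n) → Prop) (n : ℕ) :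
    weightSum K (fun _ _ => 1) n = (Nat.card {π // K n π} : ℚ⟦X⟧) := by
  classical
  rw [weightSum, Nat.card_eq_fintype_card, Fintype.card_subtype, Finset.card_filter]
  push_cast
  exact Finset.sum_congr rfl fun π _ => by by_cases h : K n π <;> simp [indic, h]

theorem diagSum_weightSum_one (K : ∀ n, Equiv.Perm (Fin n) → Prop) (hK : ∀ π, ¬ K 0 π) :
    diagSum (weightSum K fun _ _ => 1) = genFun fun n => Nat.card {π // K n π} := by
  rw [← diagSum_natCast]
  · exact congrArg _ (funext fun n => weightSum_one K n)
  · have : IsEmpty {π // K 0 π} := ⟨fun π => hK _ π.2⟩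
    simp

/-- The Catalan generating function over `ℚ`. -/
noncomputable def catSeries : ℚ⟦X⟧ := catalanSeries.map (Nat.castRingHom ℚ)

theorem X_mul_catSeries_sq : X * catSeries ^ 2 = catSeries - 1 := by
  have h := congrArg (PowerSeries.map (Nat.castRingHom ℚ)) catalanSeries_sq_mul_X_add_one
  simp only [map_add, map_mul, map_pow, map_one, PowerSeries.map_X] at h
  rw [catSeries, eq_sub_iff_add_eq, mul_comm]
  exact h

theorem eq_X_mul_catSeries {B : ℚ⟦X⟧} (hB : B = X + B * B) (h0 : constantCoeff B = 0) :
    B = X * catSeries := by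
  have h1 : (B - X * catSeries) * (B + X * catSeries - 1) = 0 := by
    linear_combination (-1) * hB - X * X_mul_catSeries_sq
  rcases mul_eq_zero.1 h1 with h | h
  · exact sub_eq_zero.1 h
  · have := congrArg constantCoeff h
    simp [h0] at this

theorem X_mul_sum_catSeries_pow (k : ℕ) :
    X * ∑ j ∈ Finset.range k, catSeries ^ (j + 2) = catSeries ^ k - 1 := by
  induction k with
  | zero => simp
  | succ k ih =>
    rw [Finset.sum_range_succ, mul_add, ih]
    linear_combination catSeries ^ k * X_mul_catSeries_sq

/-- Summing over a finite set a function of the rank. -/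
theorem sum_rank {ι M : Type*} [AddCommMonoid M] (A : Finset ι) (v : ι → ℕ)
    (hv : Function.Injective v) (f : ℕ → M) :
    ∑ e ∈ A, f (A.filter fun p => v p ≤ v e).card = ∑ j ∈ Finset.range A.card, f (j + 1) := by
  classical
  induction A using Finset.induction_on_max_value v with
  | empty => simp
  | insert a s ha hmax ih =>
    rw [Finset.sum_insert ha, Finset.card_insert_of_notMem ha, Finset.sum_range_succ, ← ih,
      add_comm]
    congr 1
    · refine Finset.sum_congr rfl fun e he => ?_
      rw [Finset.filter_insert, if_neg]
      have h1 := hmax e he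
      have h2 : v e ≠ v a := fun h => ha (hv h ▸ he)
      omega
    · rw [Finset.filter_true_of_mem, Finset.card_insert_of_notMem ha]
      intro x hx
      rcases Finset.mem_insert.1 hx with rfl | hx
      · exact le_rfl
      · exact hmax x hx

theorem skewIndec_insLast_last {n : ℕ} (ρ : Equiv.Perm (Fin n)) :
    SkewIndec (insLast ρ (Fin.last n)) := by
  refine ⟨Nat.succ_pos n, fun a h0 ha hcut => ?_⟩
  have := hcut ⟨0, Nat.succ_pos n⟩ (Fin.last n) h0 (by simpa using Nat.lt_succ_iff.1 ha)
  rw [insLast_last] at this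
  exact (Fin.le_last _).not_gt this

theorem skewIndec_glue {a b : ℕ} {τ : Equiv.Perm (Fin a)} (hτ : SkewIndec τ) (e : Fin a)
    (ρ : Equiv.Perm (Fin b)) : SkewIndec (glue τ e ρ) := by
  refine ⟨Nat.succ_pos _, fun c h0 hc hcut => ?_⟩
  rcases lt_or_ge c a with hca | hca
  · refine hτ.2 c h0 hca (IsCut.of_skewSum (ρ := ρ) fun i j hi hj => ?_)
    have := hcut i.castSucc j.castSucc hi hj
    rwa [glue, insLast_castSucc_lt] at this
  · have := hcut (Fin.castAdd b e).castSucc (Fin.last _) (by simp; omega) (by simp; omega)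
    rw [glue, insLast_last, lt_insLast_castSucc, skewSum_castAdd] at this
    simp at this

theorem maxBelowCount_eq_one_iff {n : ℕ} (σ : Equiv.Perm (Fin n)) (e : Fin n) :
    1 ≤ maxBelowCount σ (σ e + 1) ∧ (maxBelowCount σ (σ e + 1) = 1 ↔ IsRLMin σ e) := by
  classical
  have he : IsMaxBelow σ (σ e + 1) e := ⟨Nat.lt_succ_self _, fun k _ h => h⟩
  have hcard : maxBelowCount σ (σ e + 1) =
      (Finset.univ.filter fun i => IsMaxBelow σ (σ e + 1) i).card := by
    rw [Finset.card_filter]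
    exact Finset.sum_congr rfl fun _ _ => by congr
  have hemem : e ∈ Finset.univ.filter fun i => IsMaxBelow σ (σ e + 1) i := by simpa using he
  rw [hcard]
  refine ⟨Finset.card_pos.2 ⟨e, hemem⟩, ?_, fun h => ?_⟩
  · intro h1
    obtain ⟨x, hx⟩ := Finset.card_eq_one.1 h1
    have huniq : ∀ i, IsMaxBelow σ (σ e + 1) i → i = e := by
      intro i hi
      have h2 : i ∈ Finset.univ.filter fun i => IsMaxBelow σ (σ e + 1) i := by simpa using hi
      rw [hx, Finset.mem_singleton] at h2 hemem
      rw [h2, hemem]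
    have hne : (Finset.univ.filter fun i => σ i ≤ σ e).Nonempty := ⟨e, by simp⟩
    set m := (Finset.univ.filter fun i => σ i ≤ σ e).max' hne with hm
    have hm1 : σ m ≤ σ e := by simpa using Finset.max'_mem _ hne
    have hmax : ∀ q, m < q → σ e < σ q := fun q hq =>
      not_le.1 fun h => (Finset.le_max' _ q (by simpa using h)).not_gt hq
    have hme : m = e := huniq m ⟨Nat.lt_succ_of_le hm1, fun k hk _ => hmax k hk⟩
    exact fun q hq => hmax q (hme ▸ hq)
  · rw [Finset.card_eq_one]
    refine ⟨e, Finset.eq_singleton_iff_unique_mem.2 ⟨hemem, fun i hi => ?_⟩⟩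
    simp only [Finset.mem_filter, Finset.mem_univ, true_and] at hi
    by_contra hne
    have h1 : σ i ≤ σ e := Nat.lt_succ_iff.1 hi.1
    have h2 : i < e := lt_of_le_of_ne (h.le_of_lt h1) hne
    have h3 : σ i < σ e := lt_of_le_of_ne h1 fun h => hne (σ.injective h)
    have := hi.2 e h2 h3
    omega

theorem isTreeLike_glue {a b : ℕ} {τ : Equiv.Perm (Fin a)} (hτ : SkewIndec τ) (e : Fin a)
    (ρ : Equiv.Perm (Fin b)) : IsTreeLike (glue τ e ρ) ↔
      IsTreeLike τ ∧ IsRLMin τ e ∧ IsTreeLike (insLast ρ (Fin.last b)) := by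
  have h1 := hτ.le_edgeCount
  have h2 := (skewIndec_insLast_last ρ).le_edgeCount
  obtain ⟨h3, h4⟩ := maxBelowCount_eq_one_iff τ e
  rw [isTreeLike_iff, isTreeLike_iff, isTreeLike_iff, ← h4, and_iff_right (skewIndec_glue hτ e ρ),
    and_iff_right hτ, and_iff_right (skewIndec_insLast_last ρ)]
  have h5 : edgeCount (glue τ e ρ) = edgeCount τ + edgeCount ρ +
      (maxBelowCount τ (τ e + 1) + maxBelowCount ρ b) := by
    rw [glue, edgeCount_insLast, edgeCount_skewSum, ← maxBelowCount_skewSum]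
  have h6 : edgeCount (insLast ρ (Fin.last b)) = edgeCount ρ + maxBelowCount ρ b := by
    rw [edgeCount_insLast, Fin.val_last]
  rw [h5, h6]
  rw [h6] at h2
  omega

theorem isTreeLike_of_one (π : Equiv.Perm (Fin 1)) : IsTreeLike π :=
  SimpleGraph.IsTree.of_subsingleton

theorem not_isTreeLike_zero (π : Equiv.Perm (Fin 0)) : ¬ IsTreeLike π :=
  fun h => ((isTreeLike_iff π).1 h).1.1.false

theorem glueClass_isTreeLike :
    GlueClass (fun _ π => IsTreeLike π) (fun _ τ e => IsRLMin τ e) (fun _ π => IsTreeLike π) where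
  indec _ π h := ((isTreeLike_iff π).1 h).1
  one := isTreeLike_of_one
  top_one := isTreeLike_of_one
  top_zero := not_isTreeLike_zero
  glue_iff _ _ _ e ρ hτ := isTreeLike_glue hτ e ρ

theorem isRLMin_insLast_last {n : ℕ} (σ : Equiv.Perm (Fin n)) (s : Fin (n + 1)) :
    IsRLMin (insLast σ s) (Fin.last n) := fun q hq => absurd hq (Fin.le_last q).not_gt

theorem isRLMin_insLast_castSucc {n : ℕ} (σ : Equiv.Perm (Fin n)) (s : Fin (n + 1)) (i : Fin n) :
    IsRLMin (insLast σ s) i.castSucc ↔ IsRLMin σ i ∧ (σ i : ℕ) < s := by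
  constructor
  · intro h
    refine ⟨fun q hq => ?_, ?_⟩
    · rw [← insLast_castSucc_lt σ s]
      exact h _ (by simpa using hq)
    · rw [← insLast_castSucc_lt_self]
      simpa using h (Fin.last n) (Fin.castSucc_lt_last i)
  · rintro ⟨h1, h2⟩ q hq
    induction q using Fin.lastCases with
    | last => rwa [insLast_last, insLast_castSucc_lt_self]
    | cast q =>
      rw [insLast_castSucc_lt]
      exact h1 q (by simpa using hq)

theorem isRLMin_skewSum_natAdd {a b : ℕ} (τ : Equiv.Perm (Fin a)) (ρ : Equiv.Perm (Fin b))
    (j : Fin b) : IsRLMin (skewSum τ ρ) (Fin.natAdd a j) ↔ IsRLMin ρ j := by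
  constructor
  · intro h q hq
    rw [← skewSum_natAdd_lt τ]
    exact h _ (by simpa using hq)
  · intro h q hq
    induction q using Fin.addCases with
    | left q => exact absurd hq (castAdd_lt_natAdd q j).asymm
    | right q =>
      rw [skewSum_natAdd_lt]
      exact h q (by simpa using hq)

theorem not_isRLMin_skewSum_castAdd {a b : ℕ} (hb : 0 < b) (τ : Equiv.Perm (Fin a))
    (ρ : Equiv.Perm (Fin b)) (i : Fin a) : ¬ IsRLMin (skewSum τ ρ) (Fin.castAdd b i) := fun h =>
  (h (Fin.natAdd a ⟨0, hb⟩) (castAdd_lt_natAdd _ _)).asymm (skewSum_natAdd_lt_castAdd τ ρ i _)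

open Classical in
/-- The number of elements that satisfy `P` and have a value less than `s`. -/
noncomputable def countBelow {n : ℕ} (σ : Equiv.Perm (Fin n)) (P : Fin n → Prop) (s : ℕ) : ℕ :=
  (Finset.univ.filter fun i => P i ∧ (σ i : ℕ) < s).card

theorem countBelow_eq_sum {n : ℕ} (σ : Equiv.Perm (Fin n)) (P : Fin n → Prop) (s : ℕ) :
    countBelow σ P s = ∑ i, indic (P i ∧ (σ i : ℕ) < s) 1 := by
  classical
  rw [countBelow, Finset.card_filter]
  refine Finset.sum_congr rfl fun i _ => ?_
  by_cases h : P i ∧ (σ i : ℕ) < s <;> simp [indic, h]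

open Classical in
theorem card_filter_eq_countBelow {n : ℕ} (σ : Equiv.Perm (Fin n)) (P : Fin n → Prop) {s : ℕ}
    (hs : n ≤ s) : (Finset.univ.filter P).card = countBelow σ P s := by
  rw [countBelow]
  congr 1
  ext i
  simp only [Finset.mem_filter, Finset.mem_univ, true_and]
  exact (and_iff_left (by omega)).symm

theorem countBelow_skewSum {a b : ℕ} (τ : Equiv.Perm (Fin a)) (ρ : Equiv.Perm (Fin b))
    (P : Fin (a + b) → Prop) (P' : Fin b → Prop) {s : ℕ} (hs : b ≤ s)
    (hP : ∀ i, ¬ P (Fin.castAdd b i)) (hP' : ∀ j, P (Fin.natAdd a j) ↔ P' j) :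
    countBelow (skewSum τ ρ) P s = countBelow ρ P' b := by
  rw [countBelow_eq_sum, countBelow_eq_sum, Fin.sum_univ_add, Finset.sum_eq_zero, zero_add]
  · refine Finset.sum_congr rfl fun j _ => indic_congr ?_ fun _ => rfl
    rw [skewSum_natAdd, hP']
    exact and_congr_right fun _ => by omega
  · exact fun i _ => indic_neg fun h => hP i h.1

/-- The number of right-to-left minima. -/
noncomputable def rlCount {n : ℕ} (σ : Equiv.Perm (Fin n)) : ℕ := countBelow σ (IsRLMin σ) n

theorem rlCount_insLast {n : ℕ} (σ : Equiv.Perm (Fin n)) (s : Fin (n + 1)) :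
    rlCount (insLast σ s) = countBelow σ (IsRLMin σ) s + 1 := by
  rw [rlCount, countBelow_eq_sum, Fin.sum_univ_castSucc, countBelow_eq_sum]
  congr 1
  · refine Finset.sum_congr rfl fun i _ => indic_congr ?_ fun _ => rfl
    rw [isRLMin_insLast_castSucc]
    exact and_iff_left (Fin.isLt _)
  · exact indic_pos ⟨isRLMin_insLast_last σ s, Fin.isLt _⟩

theorem rlCount_glue {a b : ℕ} (hb : 0 < b) (τ : Equiv.Perm (Fin a)) (e : Fin a)
    (ρ : Equiv.Perm (Fin b)) : rlCount (glue τ e ρ) = rlCount (insLast ρ (Fin.last b)) := by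
  rw [glue, rlCount_insLast, rlCount_insLast, Fin.val_last,
    countBelow_skewSum τ ρ _ (IsRLMin ρ) (by simp)
      (not_isRLMin_skewSum_castAdd hb τ ρ) (isRLMin_skewSum_natAdd τ ρ)]

/-- Summing over the marked elements a function of their rank by value. -/
theorem sum_indic_countBelow {M : Type*} [AddCommMonoid M] {n : ℕ} (σ : Equiv.Perm (Fin n))
    (P : Fin n → Prop) (f : ℕ → M) :
    ∑ e, indic (P e) (f (countBelow σ P (σ e + 1))) =
      ∑ j ∈ Finset.range (countBelow σ P n), f (j + 1) := by
  classical
  rw [← card_filter_eq_countBelow σ P le_rfl, ← sum_rank _ (fun i => (σ i : ℕ))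
    (fun x y h => σ.injective (Fin.ext h)), Finset.sum_filter]
  refine Finset.sum_congr rfl fun e _ => ?_
  rw [Finset.filter_filter, countBelow]
  by_cases h : P e
  · rw [indic_pos h, if_pos h]
    simp only [Nat.lt_succ_iff]
  · rw [indic_neg h, if_neg h]

section algebra
variable {K : ∀ n, Equiv.Perm (Fin n) → Prop} {A : ∀ n, Equiv.Perm (Fin n) → Fin n → Prop}

theorem constantCoeff_genFun (a : ℕ → ℕ) : constantCoeff (genFun a) = 0 := by
  rw [← coeff_zero_eq_constantCoeff_apply, genFun, coeff_mk, if_pos rfl]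

/-- The generating function of a glueing class in terms of the generating functions of its marked
and of its topped members. -/
theorem GlueClass.genFun_eq (h : GlueClass K A K) :
    genFun (fun n => Nat.card {π // K n π}) = X + diagSum (siteSum K A fun _ _ _ => 1) *
      diagSum (weightSum (fun n π => K n π ∧ IsTopped π) fun _ _ => 1) := by
  rw [← diagSum_weightSum_one K h.not_zero, h.diagSum_weightSum (fun _ _ => 1) (fun _ _ => 1)
    (fun _ _ _ => 1) (fun _ _ _ _ _ => rfl) fun _ _ _ _ _ _ _ _ _ => rfl]
  ring

/-- The topped members of a glueing class are counted by the Catalan numbers. -/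
theorem GlueClass.diagSum_topped (h : GlueClass K A K) (hA : ∀ n τ e, A n τ e → IsRLMin τ e)
    (hlast : ∀ n (τ : Equiv.Perm (Fin (n + 1))), K (n + 1) τ → IsTopped τ →
      A (n + 1) τ (Fin.last n)) :
    diagSum (weightSum (fun n π => K n π ∧ IsTopped π) fun _ _ => 1) = X * catSeries := by
  apply eq_X_mul_catSeries
  · have h1 := (h.topped hA).diagSum_weightSum (fun _ _ => 1) (fun _ _ => 1) (fun _ _ _ => 1)
      (fun _ _ _ _ _ => rfl) fun _ _ _ _ _ _ _ _ _ => rfl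
    rw [h.siteSum_topped _ (fun _ _ => 1) fun n τ hτ ht => ⟨hlast n τ hτ ht, rfl⟩] at h1
    linear_combination h1
  · rw [diagSum_weightSum_one]
    · exact constantCoeff_genFun _
    · exact fun π hπ => h.not_zero π hπ.1

theorem diagSum_single_zero (c : ℚ⟦X⟧) : diagSum (fun n => if n = 0 then c else 0) = c := by
  symm
  refine eq_diagSum fun N => ?_
  simp only [mul_ite, mul_zero, Finset.sum_ite_eq', Finset.mem_range]
  split_ifs with h
  · simp
  · have : N = 0 := by omega
    simp [this]

/-- A class whose members are the sequences, under skew sums, of members of an indecomposable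
class. -/
theorem genFun_skewSum (L : ∀ n, Equiv.Perm (Fin n) → Prop) (hK : ∀ n π, K n π → SkewIndec π)
    (hL : ∀ π, L 0 π) (hKL : ∀ a b (τ : Equiv.Perm (Fin a)) (ρ : Equiv.Perm (Fin b)),
      SkewIndec τ → (L (a + b) (skewSum τ ρ) ↔ K a τ ∧ L b ρ)) :
    genFun (fun n => Nat.card {π // L n π}) * (1 - genFun fun n => Nat.card {π // K n π}) =
      genFun fun n => Nat.card {π // K n π} := by
  have hK0 : ∀ π, ¬ K 0 π := fun π hπ => (hK 0 π hπ).1.false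
  have h0 : weightSum L (fun _ _ => 1) 0 = 1 := by
    rw [weightSum, Fintype.sum_unique, indic_pos (hL _)]
  have h1 : weightSum L (fun _ _ => 1) = fun n => (if n = 0 then 1 else 0) +
      ∑ p ∈ Finset.HasAntidiagonal.antidiagonal n,
        weightSum K (fun _ _ => 1) p.1 * weightSum L (fun _ _ => 1) p.2 := by
    funext n
    rcases Nat.eq_zero_or_pos n with rfl | hn
    · rw [h0, if_pos rfl, Finset.Nat.antidiagonal_zero, Finset.sum_singleton, weightSum,
        Finset.sum_eq_zero fun π _ => indic_neg (hK0 π), zero_mul, add_zero]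
    · rw [if_neg hn.ne', zero_add, weightSum,
        sum_perm_skewSum (M := ℚ⟦X⟧) hn fun n σ => indic (L n σ) 1]
      refine Finset.sum_congr rfl fun p _ => ?_
      obtain ⟨a, b⟩ := p
      rw [weightSum, Finset.sum_mul]
      refine Finset.sum_congr rfl fun τ _ => ?_
      change indic _ _ = _
      by_cases hτ : SkewIndec τ
      swap
      · rw [indic_neg hτ, indic_neg fun hk => hτ (hK _ _ hk), zero_mul]
      rw [indic_pos hτ, indic_mul, weightSum, Finset.mul_sum, indic_sum]
      refine Finset.sum_congr rfl fun ρ _ => ?_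
      rw [mul_indic, one_mul, ← indic_and]
      exact indic_congr (hKL a b τ ρ hτ) fun _ => rfl
  have h2 : weightSum L (fun _ _ => 1) = fun n => (if n = 0 then 1 else 0) +
      ((if n = 0 then 0 else Nat.card {π // L n π} : ℕ) : ℚ⟦X⟧) := by
    funext n
    rcases Nat.eq_zero_or_pos n with rfl | hn
    · simp [h0]
    · rw [weightSum_one, if_neg hn.ne', zero_add, if_neg hn.ne']
  have h3 : diagSum (weightSum L fun _ _ => 1) = 1 + genFun fun n => Nat.card {π // L n π} := by
    rw [h2, diagSum_add, diagSum_single_zero, diagSum_natCast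
      (fun n => if n = 0 then 0 else Nat.card {π // L n π}) (if_pos rfl)]
    congr 1
    ext n
    rw [genFun, genFun, coeff_mk, coeff_mk]
    split_ifs <;> rfl
  have h4 := congrArg diagSum h1
  rw [diagSum_add, diagSum_single_zero, diagSum_mul, diagSum_weightSum_one K hK0, h3] at h4
  linear_combination h4

end algebra

section trees

theorem isRLMin_last {n : ℕ} (τ : Equiv.Perm (Fin (n + 1))) : IsRLMin τ (Fin.last n) :=
  fun q hq => absurd hq (Fin.le_last q).not_gt

theorem IsTopped.apply_last {n : ℕ} {τ : Equiv.Perm (Fin (n + 1))} (h : IsTopped τ) :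
    τ (Fin.last n) = Fin.last n := Fin.ext (by simpa using h (Fin.last n) (by simp))

theorem diagSum_topped_tree :
    diagSum (weightSum (fun _ π => IsTreeLike π ∧ IsTopped π) fun _ _ => 1) = X * catSeries :=
  glueClass_isTreeLike.diagSum_topped (fun _ _ _ h => h) fun _ τ _ _ => isRLMin_last τ

theorem rlCount_one : rlCount (1 : Equiv.Perm (Fin 1)) = 1 := by
  have h : insLast (1 : Equiv.Perm (Fin 0)) 0 = (1 : Equiv.Perm (Fin 1)) :=
    Subsingleton.elim (α := Equiv.Perm (Fin 1)) _ _
  have := rlCount_insLast (1 : Equiv.Perm (Fin 0)) 0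
  rw [h] at this
  simpa [countBelow] using this

/-- The topped trees, weighted by a power of the Catalan series. -/
theorem diagSum_topped_tree_catSeries_pow :
    diagSum (weightSum (fun _ π => IsTreeLike π ∧ IsTopped π) fun _ π => catSeries ^ rlCount π) *
      (1 - 2 * (X * catSeries)) = X * catSeries * (1 - X * catSeries) := by
  set V := diagSum (weightSum (fun _ π => IsTreeLike π ∧ IsTopped π) fun _ π =>
    catSeries ^ rlCount π) with hV
  have h1 := (glueClass_isTreeLike.topped fun _ _ _ h => h).diagSum_weightSum
    (fun _ π => catSeries ^ rlCount π) (fun _ π => catSeries ^ rlCount π)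
    (fun _ τ e => catSeries ^ (countBelow τ (IsRLMin τ) (τ e + 1) + 1))
    (fun a τ e _ _ => by rw [rlCount_insLast, Fin.val_succ])
    (fun a b τ e ρ hb _ _ _ => by rw [rlCount_glue hb])
  rw [glueClass_isTreeLike.siteSum_topped _ (fun _ π => catSeries * catSeries ^ rlCount π)
      fun n τ _ ht => ⟨isRLMin_last τ, by
        rw [ht.apply_last, rlCount, Fin.val_last, pow_succ, mul_comm]⟩,
    glueClass_isTreeLike.siteSum_topped _ (fun _ _ => 1) fun n τ _ ht => ⟨isRLMin_last τ, rfl⟩,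
    diagSum_topped_tree, ← hV, rlCount_one, pow_one] at h1
  have h2 : weightSum (fun _ π => IsTreeLike π ∧ IsTopped π)
      (fun _ π => catSeries * catSeries ^ rlCount π) = fun n => catSeries *
      weightSum (fun _ π => IsTreeLike π ∧ IsTopped π) (fun _ π => catSeries ^ rlCount π) n := by
    funext n
    simp only [weightSum, Finset.mul_sum, mul_indic]
  rw [h2, diagSum_const_mul, ← hV] at h1
  linear_combination h1

/-- The kernel method: the sum over the ranks of the sites telescopes. -/
theorem X_mul_diagSum_siteSum_tree :
    X * diagSum (siteSum (fun _ π => IsTreeLike π) (fun _ τ e => IsRLMin τ e)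
      fun _ τ e => catSeries ^ (countBelow τ (IsRLMin τ) (τ e + 1) + 1)) =
    diagSum (weightSum (fun _ π => IsTreeLike π) fun _ π => catSeries ^ rlCount π) -
      genFun treeCount := by
  have h1 : genFun treeCount = diagSum (weightSum (fun _ π => IsTreeLike π) fun _ _ => 1) :=
    (diagSum_weightSum_one _ not_isTreeLike_zero).symm
  rw [h1, ← diagSum_const_mul, ← diagSum_sub]
  congr 1
  funext n
  simp only [siteSum, weightSum, Finset.mul_sum, ← Finset.sum_sub_distrib]
  refine Finset.sum_congr rfl fun τ _ => ?_
  rw [mul_indic]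
  by_cases hτ : IsTreeLike τ
  swap
  · rw [indic_neg hτ, indic_neg hτ, indic_neg hτ, sub_zero]
  rw [indic_pos hτ, indic_pos hτ, indic_pos hτ,
    sum_indic_countBelow τ (IsRLMin τ) fun j => catSeries ^ (j + 1)]
  exact X_mul_sum_catSeries_pow _

theorem genFun_treeCount_eq_add : genFun treeCount = X + diagSum (siteSum (fun _ π => IsTreeLike π)
    (fun _ τ e => IsRLMin τ e) fun _ _ _ => 1) * (X * catSeries) := by
  rw [← diagSum_topped_tree]
  exact glueClass_isTreeLike.genFun_eq

/-- The equation that determines the generating function of tree-like permutations. -/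
theorem genFun_treeCount_mul : genFun treeCount * (1 - 3 * (X * catSeries)) =
    X * catSeries * (1 - 3 * (X * catSeries) + (X * catSeries) ^ 2) := by
  have h1 := glueClass_isTreeLike.diagSum_weightSum
    (fun _ π => catSeries ^ rlCount π) (fun _ π => catSeries ^ rlCount π)
    (fun _ τ e => catSeries ^ (countBelow τ (IsRLMin τ) (τ e + 1) + 1))
    (fun a τ e _ _ => by rw [rlCount_insLast, Fin.val_succ])
    (fun a b τ e ρ hb _ _ _ => by rw [rlCount_glue hb])
  rw [X_mul_diagSum_siteSum_tree, rlCount_one, pow_one] at h1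
  have h2 := genFun_treeCount_eq_add
  have h3 := diagSum_topped_tree_catSeries_pow
  set V := diagSum (weightSum (fun _ π => IsTreeLike π ∧ IsTopped π) fun _ π =>
    catSeries ^ rlCount π)
  set M := diagSum (siteSum (fun _ π => IsTreeLike π) (fun _ τ e => IsRLMin τ e) fun _ _ _ => 1)
  set T := genFun treeCount
  set c := catSeries
  have hc : X * c ^ 2 = c - 1 := X_mul_catSeries_sq
  have hX : (X : ℚ⟦X⟧) ≠ 0 := X_ne_zero
  have hc0 : c ≠ 0 := by
    intro h
    rw [h] at hc
    have := congrArg constantCoeff hc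
    simp at this
  apply mul_left_cancel₀ (mul_ne_zero hX hc0)
  linear_combination h1 * (X * c) * (1 - 2 * (X * c)) + M * (X * c) * h3 - (X * c) ^ 2 * h2 -
    (X * c) ^ 2 * X * hc

end trees

section forests

/-- A walk that starts in the image of an embedding whose image is closed under adjacency comes
from a walk in the domain. -/
theorem exists_walk_map_eq {V W : Type*} {G : SimpleGraph V} {H : SimpleGraph W} (f : G ↪g H)
    (hf : ∀ v y, H.Adj (f v) y → ∃ w, f w = y) {x y : W} (p : H.Walk x y) :
    ∀ v, f v = x → ∃ (w : V) (hw : f w = y) (hv : f v = x) (q : G.Walk v w),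
      (q.map f.toHom).copy hv hw = p := by
  induction p with
  | nil => exact fun v hv => ⟨v, hv, hv, .nil, by subst hv; rfl⟩
  | cons h p ih =>
    rintro v rfl
    obtain ⟨w, rfl⟩ := hf _ _ h
    obtain ⟨z, rfl, -, q, rfl⟩ := ih w rfl
    exact ⟨z, rfl, rfl, .cons (f.map_adj_iff.1 h) q, rfl⟩

theorem SimpleGraph.IsAcyclic.not_isCycle_of_embedding {V W : Type*} {G : SimpleGraph V}
    {H : SimpleGraph W} (hG : G.IsAcyclic) (f : G ↪g H)
    (hf : ∀ v y, H.Adj (f v) y → ∃ w, f w = y) (v : V) (p : H.Walk (f v) (f v)) :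
    ¬ p.IsCycle := by
  obtain ⟨w, hw, hv, q, rfl⟩ := exists_walk_map_eq f hf p v rfl
  obtain rfl := f.injective hw
  intro hc
  exact hG q ((SimpleGraph.Walk.isCycle_map_iff_of_injective f.injective).1 hc)

variable {a b : ℕ} (τ : Equiv.Perm (Fin a)) (ρ : Equiv.Perm (Fin b))

/-- The diagram of `τ` inside that of a skew sum. -/
def skewSumLeft : permGraph τ ↪g permGraph (skewSum τ ρ) where
  toFun := Fin.castAdd b
  inj' := Fin.castAdd_injective a b
  map_rel_iff' := by
    intro x y
    exact or_congr (permEdge_skewSum_castAdd τ ρ x y) (permEdge_skewSum_castAdd τ ρ y x)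

/-- The diagram of `ρ` inside that of a skew sum. -/
def skewSumRight : permGraph ρ ↪g permGraph (skewSum τ ρ) where
  toFun := Fin.natAdd a
  inj' := Fin.natAdd_injective b a
  map_rel_iff' := by
    intro x y
    exact or_congr (permEdge_skewSum_natAdd τ ρ x y) (permEdge_skewSum_natAdd τ ρ y x)

theorem isForestLike_skewSum :
    IsForestLike (skewSum τ ρ) ↔ IsForestLike τ ∧ IsForestLike ρ := by
  constructor
  · exact fun h => ⟨h.embedding (skewSumLeft τ ρ), h.embedding (skewSumRight τ ρ)⟩
  · rintro ⟨h1, h2⟩ v p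
    induction v using Fin.addCases with
    | left v =>
      refine h1.not_isCycle_of_embedding (skewSumLeft τ ρ) (fun v y hy => ?_) v p
      induction y using Fin.addCases with
      | left y => exact ⟨y, rfl⟩
      | right y =>
        exact (hy.elim (not_permEdge_skewSum_castAdd_natAdd τ ρ v y)
          (not_permEdge_skewSum_natAdd_castAdd τ ρ v y)).elim
    | right v =>
      refine h2.not_isCycle_of_embedding (skewSumRight τ ρ) (fun v y hy => ?_) v p
      induction y using Fin.addCases with
      | right y => exact ⟨y, rfl⟩
      | left y =>
        exact (hy.elim (not_permEdge_skewSum_natAdd_castAdd τ ρ y v)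
          (not_permEdge_skewSum_castAdd_natAdd τ ρ y v)).elim

theorem isTreeLike_iff_isForestLike {n : ℕ} {π : Equiv.Perm (Fin n)} (h : SkewIndec π) :
    IsTreeLike π ↔ IsForestLike π :=
  ⟨fun h' => h'.isAcyclic, fun h' => ⟨(permGraph_connected_iff π).2 h, h'⟩⟩

theorem genFun_forestCount_mul :
    genFun forestCount * (1 - genFun treeCount) = genFun treeCount :=
  genFun_skewSum (K := fun _ π => IsTreeLike π) (fun _ π => IsForestLike π)
    (fun _ π h => ((isTreeLike_iff π).1 h).1) (fun _ => SimpleGraph.IsAcyclic.of_subsingleton)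
    fun _ _ τ ρ hτ => by rw [isTreeLike_iff_isForestLike hτ, isForestLike_skewSum]

end forests

section rooted

/-- The reverse-complement of a permutation. -/
def revComp {n : ℕ} (π : Equiv.Perm (Fin n)) : Equiv.Perm (Fin n) :=
  (Fin.revPerm.trans π).trans Fin.revPerm

@[simp] theorem revComp_apply {n : ℕ} (π : Equiv.Perm (Fin n)) (i : Fin n) :
    revComp π i = (π i.rev).rev := rfl

theorem revComp_revComp {n : ℕ} (π : Equiv.Perm (Fin n)) : revComp (revComp π) = π := by
  ext i; simp

theorem PermEdge.revComp {n : ℕ} {π : Equiv.Perm (Fin n)} {i j : Fin n} (h : PermEdge π i j) :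
    PermEdge (revComp π) j.rev i.rev := by
  refine ⟨by simpa using h.1, by simpa using h.2.1, ?_⟩
  rintro ⟨k, h1, h2, h3, h4⟩
  refine h.2.2 ⟨k.rev, ?_, ?_, ?_, ?_⟩
  · rwa [← Fin.rev_lt_rev, Fin.rev_rev]
  · rwa [← Fin.rev_lt_rev, Fin.rev_rev]
  · simpa using h4
  · simpa using h3

theorem permEdge_revComp_iff {n : ℕ} {π : Equiv.Perm (Fin n)} {i j : Fin n} :
    PermEdge (revComp π) i.rev j.rev ↔ PermEdge π j i :=
  ⟨fun h => by simpa [revComp_revComp] using h.revComp, fun h => h.revComp⟩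

/-- Reversing and complementing a permutation reverses its diagram. -/
def revCompIso {n : ℕ} (π : Equiv.Perm (Fin n)) : permGraph π ≃g permGraph (revComp π) where
  toEquiv := Fin.revPerm
  map_rel_iff' := by
    intro x y
    exact (or_congr permEdge_revComp_iff permEdge_revComp_iff).trans or_comm

theorem isTreeLike_revComp {n : ℕ} (π : Equiv.Perm (Fin n)) :
    IsTreeLike (revComp π) ↔ IsTreeLike π := (revCompIso π).isTree_iff.symm

theorem isRootedTreeLike_revComp {n : ℕ} (π : Equiv.Perm (Fin n)) :
    IsRootedTreeLike (revComp π) ↔ IsTreeLike π ∧ IsTopped π := by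
  rw [IsRootedTreeLike, isTreeLike_revComp]
  refine and_congr_right fun _ => ⟨fun h i hi => ?_, fun h i hi => ?_⟩
  · have := h i.rev (by rw [Fin.val_rev]; omega)
    rw [revComp_apply, Fin.rev_rev, Fin.val_rev] at this
    omega
  · have := h i.rev (by rw [Fin.val_rev]; omega)
    rw [revComp_apply, Fin.val_rev]
    omega

theorem rootedTreeCount_eq (n : ℕ) : rootedTreeCount n =
    Nat.card {π : Equiv.Perm (Fin n) // IsTreeLike π ∧ IsTopped π} := by
  refine Nat.card_congr (Equiv.subtypeEquiv ⟨revComp, revComp, revComp_revComp, revComp_revComp⟩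
    fun π => ?_)
  change _ ↔ IsTreeLike (revComp π) ∧ IsTopped (revComp π)
  rw [← isRootedTreeLike_revComp, revComp_revComp]

theorem genFun_rootedTreeCount : genFun rootedTreeCount = X * catSeries := by
  rw [← diagSum_topped_tree, diagSum_weightSum_one _ fun π h => not_isTreeLike_zero π h.1]
  exact congrArg genFun (funext rootedTreeCount_eq)

theorem rootedTreeCount_eq_catalan {n : ℕ} (hn : 1 ≤ n) :
    rootedTreeCount n = catalan (n - 1) := by
  obtain ⟨m, rfl⟩ := Nat.exists_eq_add_of_le' hn
  have h := congrArg (coeff (m + 1)) genFun_rootedTreeCount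
  rw [genFun, coeff_mk, if_neg (Nat.succ_ne_zero m), coeff_succ_X_mul, catSeries, coeff_map,
    catalanSeries_coeff] at h
  rw [Nat.add_sub_cancel]
  have h' : (rootedTreeCount (m + 1) : ℚ) = catalan m := h
  exact_mod_cast h'

end rooted

section patterns

/-- No occurrence of `132` lies below the value `s`. -/
def Avoids132Below {n : ℕ} (σ : Equiv.Perm (Fin n)) (s : ℕ) : Prop :=
  ∀ p q r : Fin n, p < q → q < r → σ p < σ r → σ r < σ q → s ≤ (σ q : ℕ)

/-- No descending pair of values below `s` is followed by a value at least `s`. -/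
def AvoidsSplit213 {n : ℕ} (σ : Equiv.Perm (Fin n)) (s : ℕ) : Prop :=
  ∀ p q y : Fin n, p < q → q < y → σ q < σ p → (σ p : ℕ) < s → (σ y : ℕ) < s

theorem isSmoothPerm_insLast {n : ℕ} (σ : Equiv.Perm (Fin n)) (s : Fin (n + 1)) :
    IsSmoothPerm (insLast σ s) ↔ IsSmoothPerm σ ∧ Avoids132Below σ s ∧ AvoidsSplit213 σ s := by
  constructor
  · rintro ⟨h1, h2⟩
    refine ⟨⟨?_, ?_⟩, ?_, ?_⟩
    · rintro ⟨p, q, r, t, hpq, hqr, hrt, h⟩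
      refine h1 ⟨p.castSucc, q.castSucc, r.castSucc, t.castSucc, hpq, hqr, hrt, ?_⟩
      simpa only [insLast_castSucc_lt] using h
    · rintro ⟨p, q, r, t, hpq, hqr, hrt, h⟩
      refine h2 ⟨p.castSucc, q.castSucc, r.castSucc, t.castSucc, hpq, hqr, hrt, ?_⟩
      simpa only [insLast_castSucc_lt] using h
    · intro p q r hpq hqr hpr hrq
      by_contra hs
      refine h1 ⟨p.castSucc, q.castSucc, r.castSucc, Fin.last n, hpq, hqr,
        Fin.castSucc_lt_last r, ?_⟩
      rw [insLast_castSucc_lt, insLast_castSucc_lt, insLast_last, insLast_castSucc_lt_self]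
      exact ⟨hpr, hrq, not_le.1 hs⟩
    · intro p q y hpq hqy hqp hp
      by_contra hs
      refine h2 ⟨p.castSucc, q.castSucc, y.castSucc, Fin.last n, hpq, hqy,
        Fin.castSucc_lt_last y, ?_⟩
      rw [insLast_castSucc_lt, insLast_last, insLast_castSucc_lt_self, lt_insLast_castSucc]
      exact ⟨hqp, hp, not_lt.1 hs⟩
  · rintro ⟨⟨h1, h2⟩, h3, h4⟩
    constructor
    · rintro ⟨p, q, r, t, hpq, hqr, hrt, h⟩
      obtain ⟨r, rfl⟩ := Fin.exists_castSucc_eq.2 (hrt.trans_le (Fin.le_last t)).ne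
      obtain ⟨q, rfl⟩ := Fin.exists_castSucc_eq.2 (hqr.trans_le (Fin.le_last _)).ne
      obtain ⟨p, rfl⟩ := Fin.exists_castSucc_eq.2 (hpq.trans_le (Fin.le_last _)).ne
      rw [insLast_castSucc_lt, insLast_castSucc_lt] at h
      induction t using Fin.lastCases with
      | last =>
        rw [insLast_last, insLast_castSucc_lt_self] at h
        exact (h3 p q r hpq hqr h.1 h.2.1).not_gt h.2.2
      | cast t =>
        rw [insLast_castSucc_lt] at h
        exact h1 ⟨p, q, r, t, hpq, hqr, hrt, h⟩
    · rintro ⟨p, q, r, t, hpq, hqr, hrt, h⟩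
      obtain ⟨r, rfl⟩ := Fin.exists_castSucc_eq.2 (hrt.trans_le (Fin.le_last t)).ne
      obtain ⟨q, rfl⟩ := Fin.exists_castSucc_eq.2 (hqr.trans_le (Fin.le_last _)).ne
      obtain ⟨p, rfl⟩ := Fin.exists_castSucc_eq.2 (hpq.trans_le (Fin.le_last _)).ne
      rw [insLast_castSucc_lt] at h
      induction t using Fin.lastCases with
      | last =>
        rw [insLast_last, insLast_castSucc_lt_self, lt_insLast_castSucc] at h
        exact (h4 p q r hpq hqr h.1 h.2.1).not_ge h.2.2
      | cast t =>
        rw [insLast_castSucc_lt, insLast_castSucc_lt] at h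
        exact h2 ⟨p, q, r, t, hpq, hqr, hrt, h⟩

variable {a b : ℕ} (τ : Equiv.Perm (Fin a)) (ρ : Equiv.Perm (Fin b))

/-- An ascending pair of a skew sum lies in one of the summands. -/
theorem eq_castAdd_or_eq_natAdd_of_lt {x y : Fin (a + b)} (hxy : x < y)
    (h : skewSum τ ρ x < skewSum τ ρ y) :
    (∃ i j, x = Fin.castAdd b i ∧ y = Fin.castAdd b j) ∨
      ∃ i j, x = Fin.natAdd a i ∧ y = Fin.natAdd a j := by
  induction x using Fin.addCases with
  | left i =>
    induction y using Fin.addCases with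
    | left j => exact Or.inl ⟨i, j, rfl, rfl⟩
    | right j => exact absurd h (skewSum_natAdd_lt_castAdd τ ρ i j).asymm
  | right i =>
    induction y using Fin.addCases with
    | left j => exact absurd hxy (castAdd_lt_natAdd j i).asymm
    | right j => exact Or.inr ⟨i, j, rfl, rfl⟩

theorem exists_castAdd_of_lt {x : Fin (a + b)} {j : Fin a} (h : x < Fin.castAdd b j) :
    ∃ i, x = Fin.castAdd b i :=
  ⟨⟨x, by rw [Fin.lt_def] at h; exact h.trans j.2⟩, rfl⟩

theorem exists_natAdd_of_lt {x : Fin (a + b)} {j : Fin b} (h : Fin.natAdd a j < x) :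
    ∃ i, x = Fin.natAdd a i := by
  induction x using Fin.addCases with
  | left i => exact absurd h (castAdd_lt_natAdd i j).asymm
  | right i => exact ⟨i, rfl⟩

theorem isSmoothPerm_skewSum : IsSmoothPerm (skewSum τ ρ) ↔ IsSmoothPerm τ ∧ IsSmoothPerm ρ := by
  constructor
  · rintro ⟨h1, h2⟩
    refine ⟨⟨?_, ?_⟩, ⟨?_, ?_⟩⟩
    · rintro ⟨p, q, r, t, hpq, hqr, hrt, h⟩
      refine h1 ⟨Fin.castAdd b p, Fin.castAdd b q, Fin.castAdd b r, Fin.castAdd b t,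
        hpq, hqr, hrt, ?_⟩
      simpa only [skewSum_castAdd_lt] using h
    · rintro ⟨p, q, r, t, hpq, hqr, hrt, h⟩
      refine h2 ⟨Fin.castAdd b p, Fin.castAdd b q, Fin.castAdd b r, Fin.castAdd b t,
        hpq, hqr, hrt, ?_⟩
      simpa only [skewSum_castAdd_lt] using h
    · rintro ⟨p, q, r, t, hpq, hqr, hrt, h⟩
      refine h1 ⟨Fin.natAdd a p, Fin.natAdd a q, Fin.natAdd a r, Fin.natAdd a t,
        by simpa using hpq, by simpa using hqr, by simpa using hrt, ?_⟩
      simpa only [skewSum_natAdd_lt] using h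
    · rintro ⟨p, q, r, t, hpq, hqr, hrt, h⟩
      refine h2 ⟨Fin.natAdd a p, Fin.natAdd a q, Fin.natAdd a r, Fin.natAdd a t,
        by simpa using hpq, by simpa using hqr, by simpa using hrt, ?_⟩
      simpa only [skewSum_natAdd_lt] using h
  · rintro ⟨⟨h1, h2⟩, h3, h4⟩
    constructor
    · rintro ⟨p, q, r, t, hpq, hqr, hrt, h⟩
      rcases eq_castAdd_or_eq_natAdd_of_lt τ ρ (hpq.trans (hqr.trans hrt))
        (h.1.trans (h.2.1.trans h.2.2)) with ⟨p, t, rfl, rfl⟩ | ⟨p, t, rfl, rfl⟩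
      · obtain ⟨r, rfl⟩ := exists_castAdd_of_lt hrt
        obtain ⟨q, rfl⟩ := exists_castAdd_of_lt hqr
        exact h1 ⟨p, q, r, t, hpq, hqr, hrt, by simpa only [skewSum_castAdd_lt] using h⟩
      · obtain ⟨q, rfl⟩ := exists_natAdd_of_lt hpq
        obtain ⟨r, rfl⟩ := exists_natAdd_of_lt hqr
        exact h3 ⟨p, q, r, t, by simpa using hpq, by simpa using hqr, by simpa using hrt,
          by simpa only [skewSum_natAdd_lt] using h⟩
    · rintro ⟨p, q, r, t, hpq, hqr, hrt, h⟩
      rcases eq_castAdd_or_eq_natAdd_of_lt τ ρ (hpq.trans (hqr.trans hrt)) h.2.1 with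
        ⟨p, t, rfl, rfl⟩ | ⟨p, t, rfl, rfl⟩
      · obtain ⟨r, rfl⟩ := exists_castAdd_of_lt hrt
        obtain ⟨q, rfl⟩ := exists_castAdd_of_lt hqr
        exact h2 ⟨p, q, r, t, hpq, hqr, hrt, by simpa only [skewSum_castAdd_lt] using h⟩
      · obtain ⟨q, rfl⟩ := exists_natAdd_of_lt hpq
        obtain ⟨r, rfl⟩ := exists_natAdd_of_lt hqr
        exact h4 ⟨p, q, r, t, by simpa using hpq, by simpa using hqr, by simpa using hrt,
          by simpa only [skewSum_natAdd_lt] using h⟩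

theorem avoids132Below_skewSum (t : ℕ) :
    Avoids132Below (skewSum τ ρ) (b + t) ↔ Avoids132Below τ t ∧ Avoids132Below ρ b := by
  constructor
  · intro h
    constructor
    · intro p q r hpq hqr hpr hrq
      have := h (Fin.castAdd b p) (Fin.castAdd b q) (Fin.castAdd b r) hpq hqr
        (by rwa [skewSum_castAdd_lt]) (by rwa [skewSum_castAdd_lt])
      rw [skewSum_castAdd] at this
      omega
    · intro p q r hpq hqr hpr hrq
      have := h (Fin.natAdd a p) (Fin.natAdd a q) (Fin.natAdd a r) (by simpa using hpq)
        (by simpa using hqr) (by rwa [skewSum_natAdd_lt]) (by rwa [skewSum_natAdd_lt])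
      rw [skewSum_natAdd] at this
      omega
  · rintro ⟨h1, h2⟩ p q r hpq hqr hpr hrq
    rcases eq_castAdd_or_eq_natAdd_of_lt τ ρ (hpq.trans hqr) hpr with
      ⟨p, r, rfl, rfl⟩ | ⟨p, r, rfl, rfl⟩
    · obtain ⟨q, rfl⟩ := exists_castAdd_of_lt hqr
      rw [skewSum_castAdd_lt] at hpr hrq
      have := h1 p q r hpq hqr hpr hrq
      rw [skewSum_castAdd]
      omega
    · obtain ⟨q, rfl⟩ := exists_natAdd_of_lt hpq
      rw [skewSum_natAdd_lt] at hpr hrq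
      have := h2 p q r (by simpa using hpq) (by simpa using hqr) hpr hrq
      omega

theorem avoidsSplit213_skewSum (t : ℕ) :
    AvoidsSplit213 (skewSum τ ρ) (b + t) ↔ AvoidsSplit213 τ t := by
  constructor
  · intro h p q y hpq hqy hqp hp
    have := h (Fin.castAdd b p) (Fin.castAdd b q) (Fin.castAdd b y) hpq hqy
      (by rwa [skewSum_castAdd_lt]) (by rw [skewSum_castAdd]; omega)
    rw [skewSum_castAdd] at this
    omega
  · intro h p q y hpq hqy hqp hp
    induction y using Fin.addCases with
    | right y => rw [skewSum_natAdd]; omega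
    | left y =>
      obtain ⟨q, rfl⟩ := exists_castAdd_of_lt hqy
      obtain ⟨p, rfl⟩ := exists_castAdd_of_lt hpq
      rw [skewSum_castAdd_lt] at hqp
      rw [skewSum_castAdd] at hp ⊢
      have := h p q y hpq hqy hqp (by omega)
      omega

end patterns

section sites

/-- The sites of a smooth permutation above which a new last value can be inserted. -/
def IsSmoothSite {n : ℕ} (σ : Equiv.Perm (Fin n)) (e : Fin n) : Prop :=
  IsRLMin σ e ∧ AvoidsSplit213 σ (σ e + 1)

/-- The values up to that of `e` appear in increasing order. -/
def IsChainSite {n : ℕ} (σ : Equiv.Perm (Fin n)) (e : Fin n) : Prop :=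
  ∀ p q, p < q → σ q < σ p → σ e < σ p

/-- In an indecomposable permutation, the insertion conditions single out right-to-left minima. -/
theorem isRLMin_of_avoids {n : ℕ} {σ : Equiv.Perm (Fin n)} (hσ : SkewIndec σ) {e : Fin n}
    (h1 : Avoids132Below σ (σ e + 1)) (h2 : AvoidsSplit213 σ (σ e + 1)) : IsRLMin σ e := by
  intro v₀ hv₀
  by_contra hcon
  have hlt₀ : σ v₀ < σ e := lt_of_le_of_ne (not_lt.1 hcon) fun h => hv₀.ne' (σ.injective h)
  obtain ⟨v, hv, hvmax⟩ := Finset.exists_max_image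
    (Finset.univ.filter fun v => e < v ∧ σ v < σ e) σ ⟨v₀, by simp [hv₀, hlt₀]⟩
  simp only [Finset.mem_filter, Finset.mem_univ, true_and] at hv hvmax
  obtain ⟨m, hm, hmmax⟩ := Finset.exists_max_image
    (Finset.univ.filter fun i => i < v ∧ σ e ≤ σ i) id ⟨e, by simp [hv.1]⟩
  simp only [Finset.mem_filter, Finset.mem_univ, true_and, id] at hm hmmax
  have hem : e ≤ m := hmmax e ⟨hv.1, le_rfl⟩
  have hmv : (m : ℕ) < v := hm.1
  refine hσ.2 (m + 1) (Nat.succ_pos _) (by omega) fun i j hi hj => ?_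
  have hi' : i ≤ m := Fin.le_def.2 (Nat.lt_succ_iff.1 hi)
  have hj' : m < j := Fin.lt_def.2 hj
  by_contra hij
  have hij' : σ i < σ j :=
    lt_of_le_of_ne (not_lt.1 hij) fun h => (hi'.trans_lt hj').ne (σ.injective h)
  have hej : e < j := hem.trans_lt hj'
  have hjv : σ j ≤ σ v := by
    apply hvmax j
    refine ⟨hej, ?_⟩
    rcases lt_or_ge j v with h | h
    · by_contra hcon'
      exact (hmmax j ⟨h, not_lt.1 hcon'⟩).not_gt hj'
    · rcases h.lt_or_eq with h | h
      · have := h2 e v j hv.1 h hv.2 (Nat.lt_succ_self _)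
        exact lt_of_le_of_ne (Nat.lt_succ_iff.1 this) fun h' => hej.ne' (σ.injective h')
      · rw [← h]; exact hv.2
  have hiv : σ i < σ v := hij'.trans_le hjv
  rcases lt_trichotomy i e with h | h | h
  · have := h1 i e v h hv.1 hiv hv.2
    omega
  · rw [h] at hiv
    exact hiv.asymm hv.2
  · have him : i < m := lt_of_le_of_ne hi' fun h' => by
      rw [h'] at hiv
      exact (hm.2.trans_lt hiv).asymm hv.2
    have := h2 e i m h him (hiv.trans hv.2) (Nat.lt_succ_self _)
    have h3 : σ e < σ m := lt_of_le_of_ne hm.2 fun h' => (h.trans him).ne (σ.injective h')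
    rw [Fin.lt_def] at h3
    omega

theorem isSmoothSite_iff {n : ℕ} {σ : Equiv.Perm (Fin n)} (hσ : SkewIndec σ)
    (hs : IsSmoothPerm σ) (e : Fin n) : IsSmoothSite σ e ↔
      Avoids132Below σ (σ e + 1) ∧ AvoidsSplit213 σ (σ e + 1) := by
  refine ⟨fun h => ⟨fun p q r hpq hqr hpr hrq => ?_, h.2⟩,
    fun h => ⟨isRLMin_of_avoids hσ h.1 h.2, h.2⟩⟩
  by_contra hq
  have hq' : σ q ≤ σ e := Fin.le_def.2 (by omega)
  have hre : r < e := lt_of_le_of_ne (h.1.le_of_lt (hrq.le.trans hq')) fun h' => by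
    rw [h'] at hrq; exact hrq.not_ge hq'
  have hqe : σ q < σ e := lt_of_le_of_ne hq' fun h' => (hqr.trans hre).ne (σ.injective h')
  exact hs.1 ⟨p, q, r, e, hpq, hqr, hre, hpr, hrq, hqe⟩

theorem isSmoothPerm_glue {a b : ℕ} {τ : Equiv.Perm (Fin a)} (hτ : SkewIndec τ) (e : Fin a)
    (ρ : Equiv.Perm (Fin b)) : IsSmoothPerm (glue τ e ρ) ↔
      IsSmoothPerm τ ∧ IsSmoothSite τ e ∧ IsSmoothPerm (insLast ρ (Fin.last b)) := by
  have h : AvoidsSplit213 ρ b := fun _ _ y _ _ _ _ => (ρ y).2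
  rw [glue, isSmoothPerm_insLast, isSmoothPerm_insLast, isSmoothPerm_skewSum,
    avoids132Below_skewSum, avoidsSplit213_skewSum, Fin.val_last, and_iff_left h]
  constructor
  · rintro ⟨⟨h1, h2⟩, ⟨h3, h4⟩, h5⟩
    exact ⟨h1, (isSmoothSite_iff hτ h1 e).2 ⟨h3, h5⟩, h2, h4⟩
  · rintro ⟨h1, h2, h3, h4⟩
    obtain ⟨h5, h6⟩ := (isSmoothSite_iff hτ h1 e).1 h2
    exact ⟨⟨h1, h3⟩, ⟨h5, h4⟩, h6⟩

theorem isSmoothPerm_of_le {n : ℕ} (hn : n ≤ 1) (π : Equiv.Perm (Fin n)) : IsSmoothPerm π := by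
  constructor <;> rintro ⟨p, q, r, s, hpq, -⟩ <;> rw [Fin.lt_def] at hpq <;> omega

theorem skewIndec_of_one (π : Equiv.Perm (Fin 1)) : SkewIndec π :=
  ⟨Nat.one_pos, fun a h0 h1 => by omega⟩

theorem glueClass_isSmoothPerm :
    GlueClass (fun _ π => IsSmoothPerm π ∧ SkewIndec π) (fun _ τ e => IsSmoothSite τ e)
      (fun _ π => IsSmoothPerm π ∧ SkewIndec π) where
  indec _ _ h := h.2
  one π := ⟨isSmoothPerm_of_le le_rfl π, skewIndec_of_one π⟩
  top_one π := ⟨isSmoothPerm_of_le le_rfl π, skewIndec_of_one π⟩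
  top_zero _ h := h.2.1.false
  glue_iff a b τ e ρ hτ := by
    rw [and_iff_left (skewIndec_glue hτ e ρ), isSmoothPerm_glue hτ, and_iff_left hτ,
      and_iff_left (skewIndec_insLast_last ρ)]

theorem genFun_smoothCount_mul :
    genFun smoothCount * (1 - genFun fun n =>
      Nat.card {π : Equiv.Perm (Fin n) // IsSmoothPerm π ∧ SkewIndec π}) =
    genFun fun n => Nat.card {π : Equiv.Perm (Fin n) // IsSmoothPerm π ∧ SkewIndec π} :=
  genFun_skewSum (K := fun _ π => IsSmoothPerm π ∧ SkewIndec π) (fun _ π => IsSmoothPerm π)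
    (fun _ _ h => h.2) (isSmoothPerm_of_le (Nat.zero_le 1))
    fun _ _ τ ρ hτ => by rw [and_iff_left hτ, isSmoothPerm_skewSum]

end sites

section chainSites
variable {n : ℕ} {σ : Equiv.Perm (Fin n)}

theorem IsChainSite.isRLMin {e : Fin n} (h : IsChainSite σ e) : IsRLMin σ e := by
  intro q hq
  by_contra hcon
  exact lt_irrefl _ (h e q hq (lt_of_le_of_ne (not_lt.1 hcon) fun h' => hq.ne' (σ.injective h')))

theorem IsChainSite.isSmoothSite {e : Fin n} (h : IsChainSite σ e) : IsSmoothSite σ e := by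
  refine ⟨h.isRLMin, fun p q y hpq _ hqp hp => ?_⟩
  have := h p q hpq hqp
  rw [Fin.lt_def] at this
  omega

theorem IsChainSite.of_le {e e' : Fin n} (h : IsChainSite σ e) (he : σ e' ≤ σ e) :
    IsChainSite σ e' := fun p q hpq hqp => he.trans_lt (h p q hpq hqp)

theorem IsSmoothSite.le_of_not_isChainSite {e e' : Fin n} (he : IsSmoothSite σ e)
    (hc : ¬ IsChainSite σ e) (he' : IsSmoothSite σ e') : σ e' ≤ σ e := by
  by_contra hcon
  have hlt := not_le.1 hcon
  obtain ⟨p, q, hpq, hqp, hp⟩ : ∃ p q, p < q ∧ σ q < σ p ∧ σ p ≤ σ e := by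
    simpa [IsChainSite] using hc
  have hq : σ q < σ e := hqp.trans_le hp
  have hqe : q ≤ e := he.1.le_of_lt hq.le
  have hee' : e < e' := lt_of_le_of_ne (he'.1.le_of_lt hlt.le) fun h => by
    rw [h] at hlt; exact lt_irrefl _ hlt
  have := he.2 p q e' hpq (hqe.trans_lt hee') hqp (Nat.lt_succ_of_le hp)
  rw [Fin.lt_def] at hlt
  omega

theorem isSmoothSite_insLast_castSucc (s : Fin (n + 1)) (i : Fin n) :
    IsSmoothSite (insLast σ s) i.castSucc ↔ IsChainSite σ i ∧ (σ i : ℕ) < s := by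
  constructor
  · rintro ⟨h1, h2⟩
    obtain ⟨-, h4⟩ := (isRLMin_insLast_castSucc σ s i).1 h1
    refine ⟨fun p q hpq hqp => ?_, h4⟩
    by_contra hcon
    have := h2 p.castSucc q.castSucc (Fin.last n) hpq (Fin.castSucc_lt_last q)
      (by rwa [insLast_castSucc_lt]) (by
        rw [Nat.lt_succ_iff, ← Fin.le_def, ← not_lt, insLast_castSucc_lt]
        exact hcon)
    rw [insLast_last, Nat.lt_succ_iff, ← Fin.le_def, ← not_lt, insLast_castSucc_lt_self] at this
    exact this h4
  · rintro ⟨h1, h2⟩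
    refine ⟨(isRLMin_insLast_castSucc σ s i).2 ⟨h1.isRLMin, h2⟩, fun p q y hpq hqy hqp hp => ?_⟩
    exfalso
    obtain ⟨q, rfl⟩ := Fin.exists_castSucc_eq.2 (hqy.trans_le (Fin.le_last _)).ne
    obtain ⟨p, rfl⟩ := Fin.exists_castSucc_eq.2 (hpq.trans_le (Fin.le_last _)).ne
    rw [insLast_castSucc_lt] at hqp
    rw [Nat.lt_succ_iff, ← Fin.le_def, ← not_lt, insLast_castSucc_lt] at hp
    exact hp (h1 p q hpq hqp)

theorem isSmoothSite_insLast_last {s : Fin (n + 1)} (hs : AvoidsSplit213 σ s) :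
    IsSmoothSite (insLast σ s) (Fin.last n) := by
  refine ⟨isRLMin_insLast_last σ s, fun p q y hpq hqy hqp hp => ?_⟩
  rw [insLast_last, Nat.lt_succ_iff, ← Fin.le_def] at hp ⊢
  obtain ⟨q, rfl⟩ := Fin.exists_castSucc_eq.2 (hqy.trans_le (Fin.le_last _)).ne
  obtain ⟨p, rfl⟩ := Fin.exists_castSucc_eq.2 (hpq.trans_le (Fin.le_last _)).ne
  induction y using Fin.lastCases with
  | last => rw [insLast_last]
  | cast y =>
    rw [insLast_castSucc_lt] at hqp
    have hp' : insLast σ s p.castSucc < s := lt_of_le_of_ne hp (by simp [Fin.succAbove_ne])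
    rw [insLast_castSucc_lt_self] at hp'
    exact ((insLast_castSucc_lt_self σ s y).2 (hs p q y hpq hqy hqp hp')).le

theorem isChainSite_insLast_castSucc (s : Fin (n + 1)) (i : Fin n) :
    IsChainSite (insLast σ s) i.castSucc ↔ IsChainSite σ i ∧ (σ i : ℕ) < s := by
  constructor
  · exact fun h => (isSmoothSite_insLast_castSucc s i).1 h.isSmoothSite
  · rintro ⟨h1, h2⟩ p q hpq hqp
    obtain ⟨p, rfl⟩ := Fin.exists_castSucc_eq.2 (hpq.trans_le (Fin.le_last _)).ne
    rw [insLast_castSucc_lt]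
    induction q using Fin.lastCases with
    | last =>
      rw [insLast_last, lt_insLast_castSucc] at hqp
      exact Fin.lt_def.2 (h2.trans_le hqp)
    | cast q =>
      rw [insLast_castSucc_lt] at hqp
      exact h1 p q hpq hqp

theorem isChainSite_insLast_last (s : Fin (n + 1)) : IsChainSite (insLast σ s) (Fin.last n) ↔
    ∀ p q, p < q → σ q < σ p → (s : ℕ) ≤ σ p := by
  constructor
  · intro h p q hpq hqp
    have := h p.castSucc q.castSucc hpq (by rwa [insLast_castSucc_lt])
    rwa [insLast_last, lt_insLast_castSucc] at this
  · intro h p q hpq hqp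
    obtain ⟨p, rfl⟩ := Fin.exists_castSucc_eq.2 (hpq.trans_le (Fin.le_last _)).ne
    rw [insLast_last]
    induction q using Fin.lastCases with
    | last => rwa [insLast_last] at hqp
    | cast q =>
      rw [insLast_castSucc_lt] at hqp
      exact (lt_insLast_castSucc σ s p).2 (h p q hpq hqp)

theorem isChainSite_insLast_last_iff (e : Fin n) :
    IsChainSite (insLast σ (σ e).succ) (Fin.last n) ↔ IsChainSite σ e := by
  rw [isChainSite_insLast_last, Fin.val_succ]
  exact forall₄_congr fun p q _ _ => by rw [Fin.lt_def, Nat.succ_le_iff]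

variable (σ) in
/-- Every smooth site is a chain site. -/
def IsChainType : Prop := ∀ e, IsSmoothSite σ e → IsChainSite σ e

variable (σ) in
/-- The number of smooth sites. -/
noncomputable def smoothSiteCount : ℕ := countBelow σ (IsSmoothSite σ) n

variable (σ) in
/-- The number of chain sites. -/
noncomputable def chainSiteCount : ℕ := countBelow σ (IsChainSite σ) n

theorem isChainType_insLast_iff {s : Fin (n + 1)} (hs : AvoidsSplit213 σ s) :
    IsChainType (insLast σ s) ↔ IsChainSite (insLast σ s) (Fin.last n) := by
  refine ⟨fun h => h _ (isSmoothSite_insLast_last hs), fun h e he => ?_⟩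
  induction e using Fin.lastCases with
  | last => exact h
  | cast e => rwa [isChainSite_insLast_castSucc, ← isSmoothSite_insLast_castSucc]

theorem smoothSiteCount_insLast {s : Fin (n + 1)} (hs : AvoidsSplit213 σ s) :
    smoothSiteCount (insLast σ s) = countBelow σ (IsChainSite σ) s + 1 := by
  rw [smoothSiteCount, countBelow_eq_sum, Fin.sum_univ_castSucc, countBelow_eq_sum]
  congr 1
  · refine Finset.sum_congr rfl fun i _ => indic_congr ?_ fun _ => rfl
    rw [isSmoothSite_insLast_castSucc]
    exact and_iff_left (Fin.isLt _)
  · exact indic_pos ⟨isSmoothSite_insLast_last hs, Fin.isLt _⟩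

theorem IsChainType.smoothSiteCount_eq (h : IsChainType σ) :
    smoothSiteCount σ = chainSiteCount σ := by
  have : IsSmoothSite σ = IsChainSite σ :=
    funext fun e => propext ⟨h e, IsChainSite.isSmoothSite⟩
  rw [smoothSiteCount, chainSiteCount, this]

theorem exists_unique_not_isChainSite (h : ¬ IsChainType σ) :
    ∃ e, IsSmoothSite σ e ∧ ¬ IsChainSite σ e ∧
      (∀ e', IsSmoothSite σ e' → ¬ IsChainSite σ e' → e' = e) ∧
      countBelow σ (IsChainSite σ) (σ e + 1) = chainSiteCount σ := by
  obtain ⟨e, he, hc⟩ : ∃ e, IsSmoothSite σ e ∧ ¬ IsChainSite σ e := by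
    simpa [IsChainType] using h
  refine ⟨e, he, hc, fun e' he' hc' => σ.injective (le_antisymm
    (he.le_of_not_isChainSite hc he') (he'.le_of_not_isChainSite hc' he)), ?_⟩
  rw [chainSiteCount, countBelow_eq_sum, countBelow_eq_sum]
  refine Finset.sum_congr rfl fun i _ => indic_congr (and_congr_right fun hi => ?_) fun _ => rfl
  have := he.le_of_not_isChainSite hc hi.isSmoothSite
  rw [Fin.le_def] at this
  omega

theorem smoothSiteCount_of_not_isChainType (h : ¬ IsChainType σ) :
    smoothSiteCount σ = chainSiteCount σ + 1 := by
  obtain ⟨e, he, hc, huniq, -⟩ := exists_unique_not_isChainSite h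
  have h1 : ∀ i, indic (IsSmoothSite σ i ∧ (σ i : ℕ) < n) 1 =
      indic (IsChainSite σ i ∧ (σ i : ℕ) < n) 1 + indic (i = e) 1 := by
    intro i
    by_cases hi : i = e
    · subst hi
      rw [indic_pos ⟨he, Fin.isLt _⟩, indic_neg fun h => hc h.1, indic_pos rfl]
    · rw [indic_neg hi, add_zero]
      exact indic_congr (and_congr_left fun _ => ⟨fun h => by_contra fun h' => hi (huniq i h h'),
        IsChainSite.isSmoothSite⟩) fun _ => rfl
  have h2 : ∑ i, indic (i = e) 1 = 1 := by
    rw [Finset.sum_eq_single e, indic_pos rfl]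
    · exact fun i _ hi => indic_neg hi
    · simp
  rw [smoothSiteCount, countBelow_eq_sum, Finset.sum_congr rfl fun i _ => h1 i,
    Finset.sum_add_distrib, h2, chainSiteCount, countBelow_eq_sum]

theorem IsTopped.isSmoothSite_last {τ : Equiv.Perm (Fin (n + 1))} (h : IsTopped τ) :
    IsSmoothSite τ (Fin.last n) := by
  refine ⟨isRLMin_last τ, fun p q y _ _ _ _ => ?_⟩
  rw [h.apply_last]
  exact (τ y).2

theorem IsTopped.isChainType_iff {τ : Equiv.Perm (Fin (n + 1))} (h : IsTopped τ) :
    IsChainType τ ↔ IsChainSite τ (Fin.last n) :=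
  ⟨fun h' => h' _ h.isSmoothSite_last, fun h' e _ => h'.of_le (by
    rw [h.apply_last]; exact Fin.le_last _)⟩

theorem IsTopped.smoothSiteCount_pos {τ : Equiv.Perm (Fin (n + 1))} (h : IsTopped τ) :
    0 < smoothSiteCount τ := by
  classical
  rw [smoothSiteCount, countBelow]
  exact Finset.card_pos.2 ⟨Fin.last n,
    Finset.mem_filter.2 ⟨Finset.mem_univ _, h.isSmoothSite_last, Fin.isLt _⟩⟩

variable {a b : ℕ}

theorem isChainSite_skewSum_natAdd (τ : Equiv.Perm (Fin a)) (ρ : Equiv.Perm (Fin b)) (j : Fin b) :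
    IsChainSite (skewSum τ ρ) (Fin.natAdd a j) ↔ IsChainSite ρ j := by
  constructor
  · intro h p q hpq hqp
    rw [← skewSum_natAdd_lt τ]
    exact h _ (Fin.natAdd a q) (by simpa using hpq) (by rwa [skewSum_natAdd_lt])
  · intro h p q hpq hqp
    induction p using Fin.addCases with
    | left p => exact skewSum_natAdd_lt_castAdd τ ρ p j
    | right p =>
      obtain ⟨q, rfl⟩ := exists_natAdd_of_lt hpq
      rw [skewSum_natAdd_lt] at hqp ⊢
      exact h p q (by simpa using hpq) hqp

theorem smoothSiteCount_glue (hb : 0 < b) {τ : Equiv.Perm (Fin a)} {e : Fin a}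
    (he : IsSmoothSite τ e) (ρ : Equiv.Perm (Fin b)) : ¬ IsChainType (glue τ e ρ) ∧
      chainSiteCount (glue τ e ρ) = smoothSiteCount (insLast ρ (Fin.last b)) - 1 := by
  have h1 : AvoidsSplit213 (skewSum τ ρ) (b + (τ e + 1)) :=
    (avoidsSplit213_skewSum τ ρ _).2 he.2
  have h2 : ¬ IsChainType (glue τ e ρ) := by
    rw [glue, isChainType_insLast_iff h1, isChainSite_insLast_last]
    intro h
    have : b + (τ e + 1) ≤ _ := h (Fin.castAdd b e) (Fin.natAdd a ⟨0, hb⟩) (castAdd_lt_natAdd _ _)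
      (skewSum_natAdd_lt_castAdd τ ρ _ _)
    rw [skewSum_castAdd] at this
    omega
  refine ⟨h2, ?_⟩
  have h3 := smoothSiteCount_of_not_isChainType h2
  have h4 : smoothSiteCount (glue τ e ρ) = _ := smoothSiteCount_insLast h1
  rw [countBelow_skewSum τ ρ _ (IsChainSite ρ) (by simp)
    (fun i h => not_isRLMin_skewSum_castAdd hb τ ρ i h.isRLMin)
    (isChainSite_skewSum_natAdd τ ρ)] at h4
  have h5 : smoothSiteCount (insLast ρ (Fin.last b)) = countBelow ρ (IsChainSite ρ) b + 1 := by
    have := smoothSiteCount_insLast (σ := ρ) (s := Fin.last b) fun _ _ y _ _ _ _ => (ρ y).2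
    rwa [Fin.val_last] at this
  omega

end chainSites

section smoothSeries

/-- The series `(1 - X)⁻¹`. -/
noncomputable def geomSeries : ℚ⟦X⟧ := (1 - X)⁻¹

theorem geomSeries_mul : geomSeries * (1 - X) = 1 :=
  PowerSeries.inv_mul_cancel _ (by simp)

/-- The weight `x` on chain-type permutations, and `y` on the other ones. -/
noncomputable def chainCases {n : ℕ} (σ : Equiv.Perm (Fin n)) (x y : ℚ⟦X⟧) : ℚ⟦X⟧ :=
  indic (IsChainType σ) x + indic (¬ IsChainType σ) y

theorem chainCases_pos {n : ℕ} {σ : Equiv.Perm (Fin n)} (h : IsChainType σ) (x y : ℚ⟦X⟧) :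
    chainCases σ x y = x := by
  rw [chainCases, indic_pos h, indic_neg (not_not.2 h), add_zero]

theorem chainCases_neg {n : ℕ} {σ : Equiv.Perm (Fin n)} (h : ¬ IsChainType σ) (x y : ℚ⟦X⟧) :
    chainCases σ x y = y := by
  rw [chainCases, indic_pos h, indic_neg h, zero_add]

/-- The weight that makes the kernel method work for smooth permutations. -/
noncomputable def smoothWeight {n : ℕ} (σ : Equiv.Perm (Fin n)) : ℚ⟦X⟧ :=
  catSeries ^ chainSiteCount σ * chainCases σ 1 geomSeries

/-- The weight of the insertion of a last value above `e`. -/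
noncomputable def smoothSiteWeight {n : ℕ} (σ : Equiv.Perm (Fin n)) (e : Fin n) : ℚ⟦X⟧ :=
  indic (IsChainSite σ e) (catSeries ^ (countBelow σ (IsChainSite σ) (σ e + 1) + 1)) +
    indic (¬ IsChainSite σ e)
      (catSeries ^ countBelow σ (IsChainSite σ) (σ e + 1) * geomSeries)

theorem smoothSiteCount_insLast_succ {n : ℕ} {σ : Equiv.Perm (Fin n)} {e : Fin n}
    (he : IsSmoothSite σ e) : smoothSiteCount (insLast σ (σ e).succ) =
      countBelow σ (IsChainSite σ) (σ e + 1) + 1 := by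
  rw [smoothSiteCount_insLast, Fin.val_succ]
  rw [Fin.val_succ]
  exact he.2

theorem isChainType_insLast_succ {n : ℕ} {σ : Equiv.Perm (Fin n)} {e : Fin n}
    (he : IsSmoothSite σ e) : IsChainType (insLast σ (σ e).succ) ↔ IsChainSite σ e := by
  rw [isChainType_insLast_iff, isChainSite_insLast_last_iff]
  rw [Fin.val_succ]
  exact he.2

theorem smoothWeight_insLast {n : ℕ} {σ : Equiv.Perm (Fin n)} {e : Fin n}
    (he : IsSmoothSite σ e) :
    smoothWeight (insLast σ (σ e).succ) = smoothSiteWeight σ e := by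
  have h1 := smoothSiteCount_insLast_succ he
  have h2 := isChainType_insLast_succ he
  rw [smoothWeight, smoothSiteWeight]
  by_cases hc : IsChainSite σ e
  · rw [chainCases_pos (h2.2 hc), indic_pos hc, indic_neg (not_not.2 hc), add_zero, mul_one,
      ← (h2.2 hc).smoothSiteCount_eq, h1]
  · have h3 := smoothSiteCount_of_not_isChainType fun h => hc (h2.1 h)
    have h4 : chainSiteCount (insLast σ (σ e).succ) =
        countBelow σ (IsChainSite σ) (σ e + 1) := by omega
    rw [chainCases_neg fun h => hc (h2.1 h), indic_neg hc, indic_pos hc, zero_add, h4]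

/-- The kernel method: the sum over the sites telescopes. -/
theorem X_mul_sum_smoothSiteWeight {n : ℕ} (σ : Equiv.Perm (Fin n)) :
    X * ∑ e, indic (IsSmoothSite σ e) (smoothSiteWeight σ e) = smoothWeight σ - 1 := by
  have h1 : ∀ e, indic (IsSmoothSite σ e) (smoothSiteWeight σ e) =
      indic (IsChainSite σ e) (catSeries ^ (countBelow σ (IsChainSite σ) (σ e + 1) + 1)) +
      indic (IsSmoothSite σ e ∧ ¬ IsChainSite σ e)
        (catSeries ^ countBelow σ (IsChainSite σ) (σ e + 1) * geomSeries) := by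
    intro e
    rw [smoothSiteWeight]
    by_cases hc : IsChainSite σ e
    · rw [indic_pos hc.isSmoothSite, indic_pos hc, indic_neg (not_not.2 hc),
        indic_neg fun h => h.2 hc]
    · rw [indic_neg hc, indic_and, indic_pos hc, zero_add, zero_add]
  rw [Finset.sum_congr rfl fun e _ => h1 e, Finset.sum_add_distrib, mul_add,
    sum_indic_countBelow σ (IsChainSite σ) fun j => catSeries ^ (j + 1),
    X_mul_sum_catSeries_pow, smoothWeight, chainSiteCount]
  by_cases hct : IsChainType σ
  · rw [Finset.sum_eq_zero fun e _ => indic_neg fun h => h.2 (hct e h.1), chainCases_pos hct]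
    ring
  · obtain ⟨e, he, hc, huniq, hcount⟩ := exists_unique_not_isChainSite hct
    rw [Finset.sum_eq_single e, indic_pos ⟨he, hc⟩, hcount, chainSiteCount, chainCases_neg hct]
    · linear_combination (-catSeries ^ countBelow σ (IsChainSite σ) n) * geomSeries_mul
    · exact fun e' _ hne => indic_neg fun h => hne (huniq e' h.1 h.2)
    · simp

theorem insLast_castSucc_topped {n : ℕ} {τ : Equiv.Perm (Fin (n + 1))} (h : IsTopped τ) :
    countBelow τ (IsChainSite τ) (τ (Fin.last n) + 1) = chainSiteCount τ := by
  rw [h.apply_last, Fin.val_last, chainSiteCount]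

theorem smoothSiteCount_one : smoothSiteCount (1 : Equiv.Perm (Fin 1)) = 1 := by
  have h : insLast (1 : Equiv.Perm (Fin 0)) 0 = (1 : Equiv.Perm (Fin 1)) :=
    Subsingleton.elim (α := Equiv.Perm (Fin 1)) _ _
  have := smoothSiteCount_insLast (σ := (1 : Equiv.Perm (Fin 0))) (s := 0) fun p => p.elim0
  rw [h] at this
  simpa [countBelow] using this

theorem isChainType_one : IsChainType (1 : Equiv.Perm (Fin 1)) := fun _ _ p q hpq => by
  rw [Fin.lt_def] at hpq; omega

theorem weightSum_add (K : ∀ n, Equiv.Perm (Fin n) → Prop) (v w : ∀ n, Equiv.Perm (Fin n) → ℚ⟦X⟧) :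
    weightSum K (fun n π => v n π + w n π) = fun n => weightSum K v n + weightSum K w n := by
  funext n
  simp only [weightSum, ← Finset.sum_add_distrib]
  refine Finset.sum_congr rfl fun π _ => ?_
  by_cases h : K n π
  · rw [indic_pos h, indic_pos h, indic_pos h]
  · rw [indic_neg h, indic_neg h, indic_neg h, add_zero]

theorem weightSum_mul_right (K : ∀ n, Equiv.Perm (Fin n) → Prop)
    (w : ∀ n, Equiv.Perm (Fin n) → ℚ⟦X⟧) (c : ℚ⟦X⟧) :
    weightSum K (fun n π => c * w n π) = fun n => c * weightSum K w n := by
  funext n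
  simp only [weightSum, Finset.mul_sum, mul_indic]

theorem diagSum_topped_smooth :
    diagSum (weightSum (fun _ π => (IsSmoothPerm π ∧ SkewIndec π) ∧ IsTopped π) fun _ _ => 1) =
      X * catSeries :=
  glueClass_isSmoothPerm.diagSum_topped (fun _ _ _ h => h.1) fun _ _ _ ht => ht.isSmoothSite_last

theorem diagSum_topped_chain :
    diagSum (weightSum (fun _ π => (IsSmoothPerm π ∧ SkewIndec π) ∧ IsTopped π) fun _ π =>
      chainCases π (catSeries ^ (smoothSiteCount π - 1)) 0) * (1 - X * catSeries) = X := by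
  set V := diagSum (weightSum (fun _ π => (IsSmoothPerm π ∧ SkewIndec π) ∧ IsTopped π) fun _ π =>
      chainCases π (catSeries ^ (smoothSiteCount π - 1)) 0) with hV
  have h1 := (glueClass_isSmoothPerm.topped fun _ _ _ h => h.1).diagSum_weightSum
    (fun _ π => chainCases π (catSeries ^ (smoothSiteCount π - 1)) 0) (fun _ _ => 0)
    (fun _ τ e => indic (IsChainSite τ e)
      (catSeries ^ countBelow τ (IsChainSite τ) (τ e + 1)))
    (fun a τ e _ he => by
      rw [smoothSiteCount_insLast_succ he.1, Nat.add_sub_cancel]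
      by_cases hc : IsChainSite τ e
      · rw [chainCases_pos ((isChainType_insLast_succ he.1).2 hc), indic_pos hc]
      · rw [chainCases_neg fun h => hc ((isChainType_insLast_succ he.1).1 h), indic_neg hc])
    (fun a b τ e ρ hb _ he _ => chainCases_neg (smoothSiteCount_glue hb he.1 ρ).1 _ _)
  rw [glueClass_isSmoothPerm.siteSum_topped _
      (fun _ π => catSeries * chainCases π (catSeries ^ (smoothSiteCount π - 1)) 0)
      fun n τ _ ht => ⟨ht.isSmoothSite_last, by
        rw [insLast_castSucc_topped ht]
        by_cases hc : IsChainType τ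
        · have h2 := ht.smoothSiteCount_pos
          rw [chainCases_pos hc, indic_pos (ht.isChainType_iff.1 hc), ← pow_succ',
            ← hc.smoothSiteCount_eq, Nat.sub_add_cancel h2]
        · rw [chainCases_neg hc, indic_neg fun h => hc (ht.isChainType_iff.2 h), mul_zero]⟩,
    glueClass_isSmoothPerm.siteSum_topped _ (fun _ _ => 1)
      fun n τ _ ht => ⟨ht.isSmoothSite_last, rfl⟩,
    diagSum_topped_smooth, weightSum_mul_right, diagSum_const_mul, ← hV,
    chainCases_pos isChainType_one, smoothSiteCount_one] at h1
  have h2 : diagSum (weightSum (fun _ π => (IsSmoothPerm π ∧ SkewIndec π) ∧ IsTopped π)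
      fun _ _ => 0) = 0 := by
    have := diagSum_const_mul 0
      (weightSum (fun _ π => (IsSmoothPerm π ∧ SkewIndec π) ∧ IsTopped π) fun _ _ => 0)
    rw [← weightSum_mul_right] at this
    simpa using this
  rw [h2] at h1
  simp only [Nat.sub_self, pow_zero] at h1
  linear_combination h1

theorem diagSum_topped_smoothSiteCount :
    diagSum (weightSum (fun _ π => (IsSmoothPerm π ∧ SkewIndec π) ∧ IsTopped π) fun _ π =>
      catSeries ^ (smoothSiteCount π - 1)) * (1 - X * catSeries) ^ 2 =
      X * catSeries * ((1 - X * catSeries) ^ 2 + (X * catSeries) ^ 2) := by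
  have hVc := diagSum_topped_chain
  set Vc := diagSum (weightSum (fun _ π => (IsSmoothPerm π ∧ SkewIndec π) ∧ IsTopped π) fun _ π =>
      chainCases π (catSeries ^ (smoothSiteCount π - 1)) 0) with hVc'
  set Vn := diagSum (weightSum (fun _ π => (IsSmoothPerm π ∧ SkewIndec π) ∧ IsTopped π) fun _ π =>
      chainCases π 0 (catSeries ^ (smoothSiteCount π - 1))) with hVn
  have hadd : diagSum (weightSum (fun _ π => (IsSmoothPerm π ∧ SkewIndec π) ∧ IsTopped π)
      fun _ π => catSeries ^ (smoothSiteCount π - 1)) = Vc + Vn := by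
    rw [hVc', hVn, ← diagSum_add, ← weightSum_add]
    refine congrArg (fun w => diagSum (weightSum _ w)) (funext fun n => funext fun π => ?_)
    by_cases hc : IsChainType π
    · rw [chainCases_pos hc, chainCases_pos hc, add_zero]
    · rw [chainCases_neg hc, chainCases_neg hc, zero_add]
  have h1 := (glueClass_isSmoothPerm.topped fun _ _ _ h => h.1).diagSum_weightSum
    (fun _ π => chainCases π 0 (catSeries ^ (smoothSiteCount π - 1)))
    (fun _ π => catSeries ^ (smoothSiteCount π - 1))
    (fun _ τ e => indic (¬ IsChainSite τ e)
      (catSeries ^ countBelow τ (IsChainSite τ) (τ e + 1)))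
    (fun a τ e _ he => by
      rw [smoothSiteCount_insLast_succ he.1, Nat.add_sub_cancel]
      by_cases hc : IsChainSite τ e
      · rw [chainCases_pos ((isChainType_insLast_succ he.1).2 hc), indic_neg (not_not.2 hc)]
      · rw [chainCases_neg fun h => hc ((isChainType_insLast_succ he.1).1 h), indic_pos hc])
    (fun a b τ e ρ hb _ he _ => by
      obtain ⟨h2, h3⟩ := smoothSiteCount_glue hb he.1 ρ
      rw [chainCases_neg h2, smoothSiteCount_of_not_isChainType h2, h3, Nat.add_sub_cancel])
  rw [glueClass_isSmoothPerm.siteSum_topped _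
      (fun _ π => chainCases π 0 (catSeries ^ (smoothSiteCount π - 1)))
      fun n τ _ ht => ⟨ht.isSmoothSite_last, by
        rw [insLast_castSucc_topped ht]
        by_cases hc : IsChainType τ
        · rw [chainCases_pos hc, indic_neg (not_not.2 (ht.isChainType_iff.1 hc))]
        · rw [chainCases_neg hc, indic_pos fun h => hc (ht.isChainType_iff.2 h),
            smoothSiteCount_of_not_isChainType hc, Nat.add_sub_cancel]⟩,
    glueClass_isSmoothPerm.siteSum_topped _ (fun _ _ => 1)
      fun n τ _ ht => ⟨ht.isSmoothSite_last, rfl⟩,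
    diagSum_topped_smooth, ← hVn, chainCases_pos isChainType_one, smoothSiteCount_one,
    hadd] at h1
  simp only [Nat.sub_self, pow_zero] at h1
  rw [hadd]
  have hc : X * catSeries ^ 2 = catSeries - 1 := X_mul_catSeries_sq
  set c := catSeries
  have hVc2 : Vc = X * c := by
    linear_combination c * hVc + Vc * hc
  rw [hVc2] at h1 ⊢
  linear_combination h1 + (Vn - X * c) * X * hc

/-- The equation that determines the generating function of indecomposable smooth permutations. -/
theorem genFun_smooth_skewIndec_mul :
    (genFun fun n => Nat.card {π : Equiv.Perm (Fin n) // IsSmoothPerm π ∧ SkewIndec π}) *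
      (1 - 3 * (X * catSeries) + (X * catSeries) ^ 2) =
    X * catSeries * (1 - X * catSeries) * (1 - 2 * (X * catSeries)) := by
  set I := genFun fun n => Nat.card {π : Equiv.Perm (Fin n) // IsSmoothPerm π ∧ SkewIndec π}
    with hI
  have h1 := glueClass_isSmoothPerm.diagSum_weightSum (fun _ π => smoothWeight π)
    (fun _ π => geomSeries * catSeries ^ (smoothSiteCount π - 1))
    (fun _ τ e => smoothSiteWeight τ e)
    (fun a τ e _ he => smoothWeight_insLast he)
    (fun a b τ e ρ hb _ he _ => by
      obtain ⟨h2, h3⟩ := smoothSiteCount_glue hb he ρ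
      rw [smoothWeight, chainCases_neg h2, h3, mul_comm])
  have h2 : X * diagSum (siteSum (fun _ π => IsSmoothPerm π ∧ SkewIndec π)
      (fun _ τ e => IsSmoothSite τ e) fun _ τ e => smoothSiteWeight τ e) =
      diagSum (weightSum (fun _ π => IsSmoothPerm π ∧ SkewIndec π) fun _ π => smoothWeight π) -
        I := by
    rw [hI, ← diagSum_weightSum_one _ glueClass_isSmoothPerm.not_zero, ← diagSum_const_mul,
      ← diagSum_sub]
    congr 1
    funext n
    simp only [siteSum, weightSum, Finset.mul_sum (s := Finset.univ (α := Equiv.Perm (Fin n))),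
      ← Finset.sum_sub_distrib]
    refine Finset.sum_congr rfl fun τ _ => ?_
    by_cases hτ : IsSmoothPerm τ ∧ SkewIndec τ
    · rw [indic_pos hτ, indic_pos hτ, indic_pos hτ, X_mul_sum_smoothSiteWeight]
    · rw [indic_neg hτ, indic_neg hτ, indic_neg hτ, sub_zero, mul_zero]
  have h3 : smoothWeight (1 : Equiv.Perm (Fin 1)) = catSeries := by
    rw [smoothWeight, chainCases_pos isChainType_one, ← isChainType_one.smoothSiteCount_eq,
      smoothSiteCount_one, pow_one, mul_one]
  have h4 := glueClass_isSmoothPerm.genFun_eq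
  rw [diagSum_topped_smooth, ← hI] at h4
  have h5 := diagSum_topped_smoothSiteCount
  rw [weightSum_mul_right, diagSum_const_mul, h2, h3, smoothSiteCount_one, Nat.sub_self,
    pow_zero] at h1
  set V := diagSum (weightSum (fun _ π => (IsSmoothPerm π ∧ SkewIndec π) ∧ IsTopped π) fun _ π =>
    catSeries ^ (smoothSiteCount π - 1))
  set M := diagSum (siteSum (fun _ π => IsSmoothPerm π ∧ SkewIndec π)
    (fun _ τ e => IsSmoothSite τ e) fun _ _ _ => 1)
  have hc : X * catSeries ^ 2 = catSeries - 1 := X_mul_catSeries_sq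
  have hg := geomSeries_mul
  set U := geomSeries
  set c := catSeries
  have hXB : (X : ℚ⟦X⟧) = X * c * (1 - X * c) := by linear_combination X * hc
  have hX : (X : ℚ⟦X⟧) ≠ 0 := X_ne_zero
  have hc0 : c ≠ 0 := by
    intro h
    rw [h] at hc
    have := congrArg constantCoeff hc
    simp at this
  have h6 : I = X * c + M * U * (V - X) := by linear_combination h1
  set B := X * c
  have h7 : (V - X) * (1 - B) ^ 2 = B ^ 2 * (1 - X) := by
    linear_combination h5 - (1 - 2 * B) * hXB
  have h8 : U * (V - X) * (1 - B) ^ 2 = B ^ 2 := by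
    linear_combination U * h7 + B ^ 2 * hg
  have h9 : I = X + M * B := h4
  linear_combination (1 - B) ^ 2 * h6 + M * h8 - B * h9 - B * hXB

end smoothSeries

section pathGraph

/-- In a connected graph every vertex at positive distance from `r` has a neighbour that is closer
to `r`. -/
theorem SimpleGraph.Connected.exists_adj_dist {V : Type*} {G : SimpleGraph V} (hG : G.Connected)
    {r u : V} {k : ℕ} (hu : G.dist r u = k + 1) : ∃ v, G.Adj u v ∧ G.dist r v = k := by
  obtain ⟨p, hp⟩ := hG.exists_walk_length_eq_dist u r
  rw [SimpleGraph.dist_comm, hu] at hp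
  cases p with
  | nil => simp at hp
  | cons h p =>
    rename_i v
    refine ⟨v, h, ?_⟩
    have h1 : G.dist v r ≤ k := (SimpleGraph.dist_le p).trans (by simpa using hp.le)
    have h2 := hG.dist_triangle (u := r) (v := v) (w := u)
    have h3 : G.dist v u = 1 := SimpleGraph.dist_eq_one_iff_adj.2 h.symm
    rw [SimpleGraph.dist_comm] at h1
    omega

theorem dist_injective_of_degree_le_two {V : Type*} {G : SimpleGraph V} (hG : G.Connected) {r : V}
    (hr : ∀ u v, G.Adj r u → G.Adj r v → u = v)
    (hdeg : ∀ x u v y, G.Adj x u → G.Adj x v → G.Adj x y → y ≠ u → y ≠ v → u = v) :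
    Function.Injective (G.dist r) := by
  suffices h : ∀ k u v, G.dist r u = k → G.dist r v = k → u = v from
    fun u v huv => h _ u v rfl huv.symm
  intro k
  induction k with
  | zero =>
    intro u v hu hv
    rw [hG.dist_eq_zero_iff] at hu hv
    rw [← hu, ← hv]
  | succ k ih =>
    intro u v hu hv
    obtain ⟨x, hx, hxk⟩ := hG.exists_adj_dist hu
    obtain ⟨x', hx', hxk'⟩ := hG.exists_adj_dist hv
    obtain rfl := ih x x' hxk hxk'
    rcases k with _ | k
    · rw [hG.dist_eq_zero_iff] at hxk
      subst hxk
      exact hr u v hx.symm hx'.symm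
    · obtain ⟨y, hy, hyk⟩ := hG.exists_adj_dist hxk
      refine hdeg x u v y hx.symm hx'.symm hy ?_ ?_ <;> rintro rfl <;> omega

/-- A finite tree whose vertices have at most two neighbours is a path. -/
theorem nonempty_iso_pathGraph {n : ℕ} {G : SimpleGraph (Fin n)} (hG : G.IsTree)
    (hdeg : ∀ x u v y, G.Adj x u → G.Adj x v → G.Adj x y → y ≠ u → y ≠ v → u = v) :
    Nonempty (G ≃g SimpleGraph.pathGraph n) := by
  classical
  have hc := hG.connected
  obtain ⟨r, hr⟩ : ∃ r, ∀ u v, G.Adj r u → G.Adj r v → u = v := by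
    rcases subsingleton_or_nontrivial (Fin n) with hs | hs
    · obtain ⟨r⟩ := hc.nonempty
      exact ⟨r, fun u v _ _ => Subsingleton.elim u v⟩
    · obtain ⟨r, hr⟩ := hG.exists_vert_degree_one_of_nontrivial
      obtain ⟨w, hw⟩ := SimpleGraph.degree_eq_one_iff_existsUnique_adj.1 hr
      exact ⟨r, fun u v hu hv => (hw.2 u hu).trans (hw.2 v hv).symm⟩
  have hinj := dist_injective_of_degree_le_two hc hr hdeg
  have hlt : ∀ v, G.dist r v < n := by
    intro v
    obtain ⟨p, hp, hl⟩ := hc.exists_path_of_dist r v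
    have := hp.length_lt
    rw [hl, Fintype.card_fin] at this
    exact this
  let f : Fin n → Fin n := fun v => ⟨G.dist r v, hlt v⟩
  have hf : Function.Injective f := fun u v huv => hinj (by simpa [f] using huv)
  refine ⟨⟨Equiv.ofBijective f (Finite.injective_iff_bijective.1 hf), ?_⟩⟩
  intro u v
  rw [SimpleGraph.pathGraph_adj]
  change G.dist r u + 1 = G.dist r v ∨ G.dist r v + 1 = G.dist r u ↔ _
  constructor
  · rintro (h | h)
    · obtain ⟨x, hx, hxk⟩ := hc.exists_adj_dist h.symm
      rw [hinj hxk] at hx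
      exact hx.symm
    · obtain ⟨x, hx, hxk⟩ := hc.exists_adj_dist h.symm
      rw [hinj hxk] at hx
      exact hx
  · intro h
    have h1 := hc.dist_triangle (u := r) (v := u) (w := v)
    have h2 := hc.dist_triangle (u := r) (v := v) (w := u)
    rw [SimpleGraph.dist_eq_one_iff_adj.2 h] at h1
    rw [SimpleGraph.dist_eq_one_iff_adj.2 h.symm] at h2
    have h3 : G.dist r u ≠ G.dist r v := fun h' => h.ne (hinj h')
    omega

end pathGraph

section degrees

/-- The number of neighbours of `i` in the diagram. -/
noncomputable def vertexDegree {n : ℕ} (π : Equiv.Perm (Fin n)) (i : Fin n) : ℕ :=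
  ∑ j, indic ((permGraph π).Adj i j) 1

theorem vertexDegree_eq_card {n : ℕ} (π : Equiv.Perm (Fin n)) (i : Fin n)
    [DecidablePred fun j => (permGraph π).Adj i j] :
    vertexDegree π i = (Finset.univ.filter fun j => (permGraph π).Adj i j).card := by
  rw [Finset.card_filter]
  refine Finset.sum_congr rfl fun j _ => ?_
  by_cases h : (permGraph π).Adj i j <;> simp [indic, h]

theorem vertexDegree_insLast_castSucc {n : ℕ} (σ : Equiv.Perm (Fin n)) (s : Fin (n + 1))
    (i : Fin n) : vertexDegree (insLast σ s) i.castSucc =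
      vertexDegree σ i + indic (IsMaxBelow σ s i) 1 := by
  rw [vertexDegree, Fin.sum_univ_castSucc]
  refine congrArg₂ (· + ·) (Finset.sum_congr rfl fun j _ => indic_congr ?_ fun _ => rfl)
    (indic_congr ?_ fun _ => rfl)
  · exact or_congr (permEdge_insLast_castSucc σ s i j) (permEdge_insLast_castSucc σ s j i)
  · exact (or_iff_left (not_permEdge_last _ _)).trans (permEdge_insLast_last σ s i)

theorem vertexDegree_insLast_last {n : ℕ} (σ : Equiv.Perm (Fin n)) (s : Fin (n + 1)) :
    vertexDegree (insLast σ s) (Fin.last n) = maxBelowCount σ s := by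
  rw [vertexDegree, Fin.sum_univ_castSucc, indic_neg (SimpleGraph.irrefl _), add_zero]
  refine Finset.sum_congr rfl fun j _ => indic_congr ?_ fun _ => rfl
  exact (or_iff_right (not_permEdge_last _ _)).trans (permEdge_insLast_last σ s j)

theorem vertexDegree_skewSum_castAdd {a b : ℕ} (τ : Equiv.Perm (Fin a)) (ρ : Equiv.Perm (Fin b))
    (i : Fin a) : vertexDegree (skewSum τ ρ) (Fin.castAdd b i) = vertexDegree τ i := by
  rw [vertexDegree, Fin.sum_univ_add, Finset.sum_eq_zero (s := Finset.univ (α := Fin b)), add_zero]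
  · exact Finset.sum_congr rfl fun j _ => indic_congr ((skewSumLeft τ ρ).map_adj_iff) fun _ => rfl
  · exact fun j _ => indic_neg fun h => h.elim (not_permEdge_skewSum_castAdd_natAdd τ ρ i j)
      (not_permEdge_skewSum_natAdd_castAdd τ ρ i j)

theorem vertexDegree_skewSum_natAdd {a b : ℕ} (τ : Equiv.Perm (Fin a)) (ρ : Equiv.Perm (Fin b))
    (i : Fin b) : vertexDegree (skewSum τ ρ) (Fin.natAdd a i) = vertexDegree ρ i := by
  rw [vertexDegree, Fin.sum_univ_add, Finset.sum_eq_zero (s := Finset.univ (α := Fin a)), zero_add]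
  · exact Finset.sum_congr rfl fun j _ => indic_congr ((skewSumRight τ ρ).map_adj_iff) fun _ => rfl
  · exact fun j _ => indic_neg fun h => h.elim (not_permEdge_skewSum_natAdd_castAdd τ ρ j i)
      (not_permEdge_skewSum_castAdd_natAdd τ ρ j i)

theorem permGraph_one (n : ℕ) : permGraph (1 : Equiv.Perm (Fin n)) = SimpleGraph.pathGraph n := by
  have key : ∀ i j : Fin n, PermEdge 1 i j ↔ (i : ℕ) + 1 = j := by
    intro i j
    constructor
    · rintro ⟨h1, -, h2⟩
      rw [Fin.lt_def] at h1
      by_contra hne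
      exact h2 ⟨⟨i + 1, by omega⟩, by simp [Fin.lt_def], Fin.lt_def.2 (by simp; omega),
        by simp [Fin.lt_def], Fin.lt_def.2 (by simp; omega)⟩
    · intro h
      have hij : i < j := Fin.lt_def.2 (by omega)
      refine ⟨hij, hij, ?_⟩
      rintro ⟨k, h1, h2, -⟩
      rw [Fin.lt_def] at h1 h2
      omega
  ext i j
  rw [SimpleGraph.pathGraph_adj]
  exact or_congr (key i j) (key j i)

theorem insLast_one (n : ℕ) : insLast (1 : Equiv.Perm (Fin n)) (Fin.last n) = 1 := by
  ext i
  induction i using Fin.lastCases <;> simp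

theorem isTreeLike_one (n : ℕ) : IsTreeLike (1 : Equiv.Perm (Fin (n + 1))) := by
  induction n with
  | zero => exact isTreeLike_of_one 1
  | succ n ih =>
    have h1 := ((isTreeLike_iff _).1 ih).1
    have h := (isTreeLike_glue h1 (Fin.last n) (1 : Equiv.Perm (Fin 0))).2
      ⟨ih, isRLMin_last _, isTreeLike_of_one _⟩
    have h2 : IsTreeLike (insLast (1 : Equiv.Perm (Fin (n + 1))) (Fin.last n).succ) := by
      have := glue_zero (1 : Equiv.Perm (Fin (n + 1))) (Fin.last n) (1 : Equiv.Perm (Fin 0))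
      exact this ▸ h
    rw [← insLast_one]
    exact h2

theorem vertexDegree_one_le {n : ℕ} (i : Fin n) : vertexDegree 1 i ≤ 2 := by
  classical
  rw [vertexDegree_eq_card, permGraph_one, ← Finset.card_image_of_injective _ Fin.val_injective]
  refine (Finset.card_le_card (t := {(i : ℕ) - 1, (i : ℕ) + 1}) ?_).trans Finset.card_le_two
  intro x hx
  simp only [Finset.mem_image, Finset.mem_filter, Finset.mem_univ, true_and,
    SimpleGraph.pathGraph_adj] at hx
  obtain ⟨j, hj, rfl⟩ := hx
  simp
  omega

/-- An element of the increasing permutation is an end of the path exactly at both extremities. -/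
theorem vertexDegree_one_le_one_iff {n : ℕ} (i : Fin n) :
    vertexDegree 1 i ≤ 1 ↔ (i : ℕ) = 0 ∨ (i : ℕ) + 1 = n := by
  classical
  rw [vertexDegree_eq_card, permGraph_one]
  constructor
  · intro h
    by_contra! hcon
    rw [Finset.card_le_one] at h
    have := h ⟨i - 1, by omega⟩ (by simp [SimpleGraph.pathGraph_adj]; omega)
      ⟨i + 1, by omega⟩ (by simp [SimpleGraph.pathGraph_adj])
    simp at this
  · intro h
    rw [Finset.card_le_one]
    intro x hx y hy
    simp only [Finset.mem_filter, Finset.mem_univ, true_and, SimpleGraph.pathGraph_adj] at hx hy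
    ext
    omega

theorem isPathLike_iff {n : ℕ} (hn : 0 < n) (π : Equiv.Perm (Fin n)) :
    IsPathLike π ↔ IsTreeLike π ∧ ∀ i, vertexDegree π i ≤ 2 := by
  classical
  constructor
  · rintro ⟨f⟩
    obtain ⟨m, rfl⟩ := Nat.exists_eq_add_of_le' hn
    refine ⟨f.isTree_iff.2 (permGraph_one _ ▸ isTreeLike_one m), fun i => ?_⟩
    rw [← permGraph_one] at f
    refine le_trans (le_of_eq ?_) (vertexDegree_one_le (f i))
    rw [vertexDegree, vertexDegree,
      ← f.toEquiv.sum_comp fun j => indic ((permGraph 1).Adj (f i) j) 1]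
    exact Finset.sum_congr rfl fun j _ => indic_congr f.map_adj_iff.symm fun _ => rfl
  · rintro ⟨h1, h2⟩
    refine nonempty_iso_pathGraph h1 fun x u v y hu hv hy hyu hyv => ?_
    by_contra huv
    have h3 := h2 x
    rw [vertexDegree_eq_card] at h3
    have h4 : ({y, u, v} : Finset (Fin n)) ⊆
        Finset.univ.filter fun j => (permGraph π).Adj x j := by
      intro z hz
      simp only [Finset.mem_insert, Finset.mem_singleton] at hz
      rcases hz with rfl | rfl | rfl <;> simpa
    have h5 := Finset.card_le_card h4
    rw [Finset.card_eq_three.2 ⟨y, u, v, hyu, hyv, huv, rfl⟩] at h5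
    omega

end degrees

section paths

/-- Every nonempty permutation is a skew sum whose first summand is indecomposable. -/
theorem skewSum_induction {P : ∀ n, Equiv.Perm (Fin n) → Prop}
    (h : ∀ a b (τ : Equiv.Perm (Fin a)) (ρ : Equiv.Perm (Fin b)), SkewIndec τ →
      P (a + b) (skewSum τ ρ)) {n : ℕ} (hn : 0 < n) (σ : Equiv.Perm (Fin n)) : P n σ := by
  have h1 := sum_perm_skewSum (M := ℕ) hn fun n σ => indic (¬ P n σ) 1
  rw [Finset.sum_eq_zero (s := Finset.HasAntidiagonal.antidiagonal n)] at h1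
  · by_contra hσ
    have := Finset.sum_eq_zero_iff.1 h1 σ (Finset.mem_univ σ)
    rw [indic_pos hσ] at this
    exact one_ne_zero this
  · intro p _
    refine Finset.sum_eq_zero fun τ _ => ?_
    split_ifs with hτ
    · exact Finset.sum_eq_zero fun ρ _ => indic_neg (not_not.2 (h _ _ τ ρ hτ))
    · rfl

/-- Members of a glueing class of size at least two are obtained by glueing. -/
theorem GlueClass.induction {K : ∀ n, Equiv.Perm (Fin n) → Prop}
    {A : ∀ n, Equiv.Perm (Fin n) → Fin n → Prop} {Q : ∀ n, Equiv.Perm (Fin n) → Prop}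
    (hK : GlueClass K A Q) {P : ∀ n, Equiv.Perm (Fin n) → Prop} (h1 : ∀ π, P 1 π)
    (h : ∀ a b τ e ρ, K a τ → A a τ e → Q (b + 1) (insLast ρ (Fin.last b)) → P a τ →
      P (a + b + 1) (glue τ e ρ)) (n : ℕ) : ∀ π, K n π → P n π := by
  induction n using Nat.strong_induction_on with
  | _ n ih =>
    rcases n with _ | n
    · exact fun π hπ => absurd hπ (hK.not_zero π)
    rcases Nat.eq_zero_or_pos n with rfl | hn
    · exact fun π _ => h1 π
    intro π hπ
    obtain ⟨⟨σ, s⟩, rfl⟩ := insLast_bijective.2 π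
    revert s ih
    refine skewSum_induction (P := fun n σ => (∀ m < n + 1, ∀ π, K m π → P m π) →
      ∀ s, K (n + 1) (insLast σ s) → P (n + 1) (insLast σ s)) (fun a b τ ρ hτ ih s hs => ?_) hn σ
    rcases le_or_gt (s : ℕ) b with hsb | hsb
    · have hpos := hτ.1
      exact absurd (isCut_insLast_skewSum τ ρ s hsb)
        ((hK.indec _ _ hs).2 a hpos (by omega))
    · have hsa : (s : ℕ) - b - 1 < a := by omega
      have hse : s = ⟨b + (τ (τ.symm ⟨s - b - 1, hsa⟩) + 1), by simp; omega⟩ := by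
        ext
        simp
        omega
      rw [hse] at hs ⊢
      obtain ⟨h2, h3, h4⟩ := (hK.glue_iff a b τ _ ρ hτ).1 hs
      exact h a b τ _ ρ h2 h3 h4 (ih a (by omega) τ h2)

/-- Sites of a path above which a new last value can be inserted. -/
def IsPathSite {n : ℕ} (σ : Equiv.Perm (Fin n)) (e : Fin n) : Prop :=
  IsRLMin σ e ∧ vertexDegree σ e ≤ 1

theorem isMaxBelow_self {n : ℕ} (σ : Equiv.Perm (Fin n)) (e : Fin n) :
    IsMaxBelow σ (σ e + 1) e := ⟨Nat.lt_succ_self _, fun _ _ h => h⟩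

theorem eq_of_isMaxBelow {n : ℕ} {σ : Equiv.Perm (Fin n)} {e i : Fin n} (h : IsRLMin σ e)
    (hi : IsMaxBelow σ (σ e + 1) i) : i = e := by
  by_contra hne
  have h1 : σ i ≤ σ e := Nat.lt_succ_iff.1 hi.1
  have h2 : i < e := lt_of_le_of_ne (h.le_of_lt h1) hne
  have h3 : σ i < σ e := lt_of_le_of_ne h1 fun h => hne (σ.injective h)
  have := hi.2 e h2 h3
  omega

/-- A tree with a maximum of degree at most one, and all degrees at most two, is a chain. -/
theorem eq_one_of_isTreeLike_insLast {n : ℕ} (ρ : Equiv.Perm (Fin n))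
    (h1 : IsTreeLike (insLast ρ (Fin.last n))) (h2 : maxBelowCount ρ n ≤ 1)
    (h3 : ∀ j, vertexDegree ρ j + indic (IsMaxBelow ρ n j) 1 ≤ 2) : ρ = 1 := by
  induction n with
  | zero => exact Subsingleton.elim _ _
  | succ n ih =>
    obtain ⟨⟨ρ, s⟩, rfl⟩ := insLast_bijective.2 ρ
    simp only at h1 h2 h3 ⊢
    obtain ⟨h4, h5⟩ := maxBelowCount_eq_one_iff (insLast ρ s) ((insLast ρ s).symm (Fin.last n))
    rw [Equiv.apply_symm_apply, Fin.val_last] at h4 h5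
    have h6 := h5.1 (le_antisymm h2 h4)
    have h7 : (insLast ρ s).symm (Fin.last n) = Fin.last n := by
      by_contra hne
      have := h6 (Fin.last n) (lt_of_le_of_ne (Fin.le_last _) hne)
      rw [Equiv.apply_symm_apply] at this
      exact (Fin.le_last _).not_gt this
    obtain rfl : s = Fin.last n := by
      rw [← insLast_last ρ s, ← h7, Equiv.apply_symm_apply, h7]
    have h8 : IsTreeLike (insLast ρ (Fin.last n)) := by
      rw [isTreeLike_iff] at h1 ⊢
      rw [edgeCount_insLast, Fin.val_last] at h1
      exact ⟨skewIndec_insLast_last ρ, by omega⟩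
    have h9 : ρ = 1 := by
      refine ih ρ h8 ?_ fun j => ?_
      · have h10 := h3 (Fin.last n)
        rw [vertexDegree_insLast_last, indic_pos, Fin.val_last] at h10
        · omega
        · have := isMaxBelow_self (insLast ρ (Fin.last n)) (Fin.last n)
          rwa [insLast_last, Fin.val_last] at this
      · have h10 := h3 j.castSucc
        rw [vertexDegree_insLast_castSucc, Fin.val_last] at h10
        omega
    rw [h9, insLast_one]

theorem insLast_last_eq_one_iff {n : ℕ} {ρ : Equiv.Perm (Fin n)} :
    insLast ρ (Fin.last n) = 1 ↔ ρ = 1 := by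
  rw [← insLast_one]
  constructor
  · intro h
    exact congrArg Prod.fst (insLast_injective (a₁ := (ρ, _)) (a₂ := (1, _)) h)
  · rintro rfl
    rfl

theorem maxBelowCount_one_le (n : ℕ) : maxBelowCount (1 : Equiv.Perm (Fin n)) n ≤ 1 := by
  rcases n with _ | n
  · simp [maxBelowCount]
  · exact ((maxBelowCount_eq_one_iff (1 : Equiv.Perm (Fin (n + 1))) (Fin.last n)).2.2
      (isRLMin_last _)).le

theorem vertexDegree_glue_castAdd {a b : ℕ} (τ : Equiv.Perm (Fin a)) (e : Fin a)
    (ρ : Equiv.Perm (Fin b)) (i : Fin a) :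
    vertexDegree (glue τ e ρ) (Fin.castAdd b i).castSucc =
      vertexDegree τ i + indic (IsMaxBelow τ (τ e + 1) i) 1 := by
  rw [glue, vertexDegree_insLast_castSucc, vertexDegree_skewSum_castAdd]
  exact congrArg _ (indic_congr (isMaxBelow_skewSum_castAdd τ ρ _ i) fun _ => rfl)

theorem vertexDegree_glue_natAdd {a b : ℕ} (τ : Equiv.Perm (Fin a)) (e : Fin a)
    (ρ : Equiv.Perm (Fin b)) (j : Fin b) :
    vertexDegree (glue τ e ρ) (Fin.natAdd a j).castSucc =
      vertexDegree (insLast ρ (Fin.last b)) j.castSucc := by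
  rw [glue, vertexDegree_insLast_castSucc, vertexDegree_skewSum_natAdd,
    vertexDegree_insLast_castSucc, Fin.val_last]
  exact congrArg _ (indic_congr (isMaxBelow_skewSum_natAdd τ ρ _ j) fun _ => rfl)

theorem vertexDegree_glue_last {a b : ℕ} (τ : Equiv.Perm (Fin a)) (e : Fin a)
    (ρ : Equiv.Perm (Fin b)) : vertexDegree (glue τ e ρ) (Fin.last _) =
      maxBelowCount τ (τ e + 1) + maxBelowCount ρ b := by
  rw [glue, vertexDegree_insLast_last]
  exact maxBelowCount_skewSum τ ρ _

theorem glueClass_isPathLike :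
    GlueClass (fun _ π => IsTreeLike π ∧ ∀ i, vertexDegree π i ≤ 2) (fun _ τ e => IsPathSite τ e)
      (fun n π => 0 < n ∧ π = 1) where
  indec _ π h := ((isTreeLike_iff π).1 h.1).1
  one π := ⟨isTreeLike_of_one π, fun i => by
    rw [Subsingleton.elim π 1]; exact vertexDegree_one_le i⟩
  top_one π := ⟨Nat.one_pos, Subsingleton.elim _ _⟩
  top_zero _ h := h.1.false
  glue_iff a b τ e ρ hτ := by
    rw [isTreeLike_glue hτ, and_iff_right (Nat.succ_pos b), insLast_last_eq_one_iff]
    constructor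
    · rintro ⟨⟨h1, h2, h3⟩, h4⟩
      have h5 := (maxBelowCount_eq_one_iff τ e).2.2 h2
      have h6 : ∀ i, vertexDegree τ i + indic (IsMaxBelow τ (τ e + 1) i) 1 ≤ 2 := fun i => by
        rw [← vertexDegree_glue_castAdd τ e ρ i]; exact h4 _
      refine ⟨⟨h1, fun i => le_trans (Nat.le_add_right _ _) (h6 i)⟩, ⟨h2, ?_⟩, ?_⟩
      · have := h6 e
        rw [indic_pos (isMaxBelow_self τ e)] at this
        omega
      · refine eq_one_of_isTreeLike_insLast ρ h3 ?_ fun j => ?_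
        · have := h4 (Fin.last _)
          rw [vertexDegree_glue_last, h5] at this
          omega
        · have := h4 (Fin.natAdd a j).castSucc
          rwa [vertexDegree_glue_natAdd, vertexDegree_insLast_castSucc, Fin.val_last] at this
    · rintro ⟨⟨h1, h2⟩, ⟨h3, h4⟩, rfl⟩
      have h5 := (maxBelowCount_eq_one_iff τ e).2.2 h3
      refine ⟨⟨h1, h3, by rw [insLast_one]; exact isTreeLike_one b⟩, fun i => ?_⟩
      induction i using Fin.lastCases with
      | last =>
        have := maxBelowCount_one_le b
        rw [vertexDegree_glue_last, h5]
        omega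
      | cast i =>
        induction i using Fin.addCases with
        | left i =>
          rw [vertexDegree_glue_castAdd]
          by_cases hi : IsMaxBelow τ (τ e + 1) i
          · rw [indic_pos hi, eq_of_isMaxBelow h3 hi]
            omega
          · rw [indic_neg hi]
            exact h2 i
        | right j =>
          rw [vertexDegree_glue_natAdd, insLast_one]
          exact vertexDegree_one_le _

theorem isPathSite_one_iff {n : ℕ} (i : Fin n) :
    IsPathSite 1 i ↔ (i : ℕ) = 0 ∨ (i : ℕ) + 1 = n := by
  rw [IsPathSite, vertexDegree_one_le_one_iff]
  exact and_iff_right fun q hq => hq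

theorem isPathSite_insLast_castSucc {n : ℕ} {τ : Equiv.Perm (Fin n)} {e : Fin n}
    (he : IsRLMin τ e) (i : Fin n) : IsPathSite (insLast τ (τ e).succ) i.castSucc ↔
      IsRLMin τ i ∧ τ i ≤ τ e ∧ vertexDegree τ i + indic (i = e) 1 ≤ 1 := by
  rw [IsPathSite, isRLMin_insLast_castSucc, vertexDegree_insLast_castSucc, Fin.val_succ, and_assoc,
    Nat.lt_succ_iff, ← Fin.le_def]
  refine and_congr_right fun _ => and_congr_right fun _ => ?_
  rw [indic_congr (x := 1) (y := 1) ⟨eq_of_isMaxBelow he, fun h => h ▸ isMaxBelow_self τ i⟩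
    fun _ => rfl]

theorem IsTreeLike.vertexDegree_pos {n : ℕ} {τ : Equiv.Perm (Fin n)} (h : IsTreeLike τ)
    (hn : 2 ≤ n) (i : Fin n) : 0 < vertexDegree τ i := by
  classical
  have : Nontrivial (Fin n) := Fin.nontrivial_iff_two_le.2 hn
  obtain ⟨j, hj⟩ := h.connected.preconnected.exists_adj_of_nontrivial i
  rw [vertexDegree_eq_card]
  exact Finset.card_pos.2 ⟨j, by simpa using hj⟩

/-- A path that is not an increasing permutation has a single site. -/
theorem existsUnique_isPathSite (n : ℕ) : ∀ π : Equiv.Perm (Fin n),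
    (IsTreeLike π ∧ ∀ i, vertexDegree π i ≤ 2) → π ≠ 1 → ∃! e, IsPathSite π e := by
  refine glueClass_isPathLike.induction (P := fun n π => π ≠ 1 → ∃! e, IsPathSite π e)
    (fun π h => absurd (Subsingleton.elim π 1) h)
    (fun a b τ e ρ hτ he hρ ih hne => ?_) n
  obtain rfl := insLast_last_eq_one_iff.1 hρ.2
  have hmb := (maxBelowCount_eq_one_iff τ e).2.2 he.1
  rcases Nat.eq_zero_or_pos b with rfl | hb
  · have hglue := glue_zero τ e (1 : Equiv.Perm (Fin 0))
    have hne' : insLast τ (τ e).succ ≠ 1 := fun h => hne (hglue.trans h)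
    suffices h : ∃! i, IsPathSite (insLast τ (τ e).succ) i by
      rw [← hglue] at h
      exact h
    refine ⟨Fin.last a, ⟨isRLMin_last _, ?_⟩, fun i hi => ?_⟩
    · rw [vertexDegree_insLast_last, Fin.val_succ, hmb]
    induction i using Fin.lastCases with
    | last => rfl
    | cast i =>
      exfalso
      obtain ⟨h1, h2, h3⟩ := (isPathSite_insLast_castSucc he.1 i).1 hi
      by_cases hie : i = e
      · subst hie
        rw [indic_pos rfl] at h3
        rcases lt_or_ge a 2 with ha | ha
        · obtain rfl : a = 1 := by have := i.2; omega
          apply hne'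
          rw [Subsingleton.elim τ 1, Subsingleton.elim i (Fin.last 0)]
          exact insLast_one 1
        · have := hτ.1.vertexDegree_pos ha i
          omega
      · rw [indic_neg hie, add_zero] at h3
        by_cases h1τ : τ = 1
        · subst h1τ
          have h4 := (isPathSite_one_iff i).1 ⟨h1, h3⟩
          have h5 := (isPathSite_one_iff e).1 he
          have h6 : (i : ℕ) ≤ e := h2
          have h7 : (i : ℕ) ≠ e := fun h => hie (Fin.ext h)
          apply hne'
          have h8 : (e.succ : Fin (a + 1)) = Fin.last a := by
            ext
            simp
            omega
          rw [Equiv.Perm.one_apply, h8, insLast_one]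
        · obtain ⟨x, -, hx⟩ := ih h1τ
          exact hie ((hx i ⟨h1, h3⟩).trans (hx e he).symm)
  · refine ⟨(Fin.natAdd a ⟨0, hb⟩).castSucc, ⟨?_, ?_⟩, fun i hi => ?_⟩
    · rw [glue, isRLMin_insLast_castSucc, isRLMin_skewSum_natAdd, skewSum_natAdd]
      exact ⟨fun q hq => hq, by simp⟩
    · rw [vertexDegree_glue_natAdd, insLast_one, vertexDegree_one_le_one_iff]
      exact Or.inl rfl
    · induction i using Fin.lastCases with
      | last =>
        exfalso
        have h1 := hi.2
        rw [vertexDegree_glue_last, hmb] at h1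
        obtain ⟨c, rfl⟩ := Nat.exists_eq_add_of_le' hb
        have h2 := (maxBelowCount_eq_one_iff (1 : Equiv.Perm (Fin (c + 1))) (Fin.last c)).1
        rw [Equiv.Perm.one_apply, Fin.val_last] at h2
        change 1 + maxBelowCount (1 : Equiv.Perm (Fin (c + 1))) (c + 1) ≤ 1 at h1
        omega
      | cast i =>
        have h1 := hi.1
        rw [glue, isRLMin_insLast_castSucc] at h1
        induction i using Fin.addCases with
        | left i => exact absurd h1.1 (not_isRLMin_skewSum_castAdd hb τ 1 i)
        | right j =>
          have h2 := hi.2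
          rw [vertexDegree_glue_natAdd, insLast_one, vertexDegree_one_le_one_iff] at h2
          have h3 := j.2
          rw [Fin.val_castSucc] at h2
          have h4 : j = ⟨0, hb⟩ := Fin.ext (by simp; omega)
          rw [h4]

theorem sum_isPathSite {n : ℕ} {π : Equiv.Perm (Fin n)}
    (h : IsTreeLike π ∧ ∀ i, vertexDegree π i ≤ 2) :
    ∑ e, indic (IsPathSite π e) (1 : ℚ⟦X⟧) = 1 + indic (2 ≤ n ∧ π = 1) 1 := by
  classical
  have hpos := ((isTreeLike_iff π).1 h.1).1.1
  obtain ⟨m, rfl⟩ := Nat.exists_eq_add_of_le' hpos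
  by_cases h1 : π = 1
  · subst h1
    rcases m with _ | m
    · rw [Fin.sum_univ_one, indic_pos ((isPathSite_one_iff _).2 (Or.inl rfl)),
        indic_neg (by omega), add_zero]
    · rw [indic_pos ⟨by omega, rfl⟩, Fin.sum_univ_succ, Fin.sum_univ_castSucc,
        indic_pos ((isPathSite_one_iff _).2 (Or.inl rfl)),
        indic_pos ((isPathSite_one_iff _).2 (Or.inr (by simp))), Finset.sum_eq_zero, zero_add]
      intro i _
      refine indic_neg fun hi => ?_
      have := (isPathSite_one_iff _).1 hi
      simp at this
      omega
  · obtain ⟨e, he, huniq⟩ := existsUnique_isPathSite _ π h h1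
    rw [indic_neg fun h => h1 h.2, add_zero, Finset.sum_eq_single e, indic_pos he]
    · exact fun i _ hi => indic_neg fun h => hi (huniq i h)
    · simp

end paths

section pathSeries

theorem weightSum_one_perm (K : ∀ n, Equiv.Perm (Fin n) → Prop)
    (hK : ∀ n, 0 < n → K n 1) {c : ℕ} (n : ℕ) (hc : 0 < c) :
    weightSum (fun n π => K n π ∧ c ≤ n ∧ π = 1) (fun _ _ => 1) n = if c ≤ n then 1 else 0 := by
  rw [weightSum, Finset.sum_eq_single 1]
  · by_cases h : c ≤ n
    · rw [if_pos h, indic_pos ⟨hK n (by omega), h, rfl⟩]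
    · rw [if_neg h, indic_neg fun h' => h h'.2.1]
  · exact fun π _ hπ => indic_neg fun h => hπ h.2.2
  · simp

theorem genFun_one_mul : genFun (fun _ => 1) * (1 - X) = X := by
  ext n
  rcases n with _ | n
  · simp [genFun]
  · rw [mul_sub, mul_one, map_sub, coeff_succ_mul_X, genFun, coeff_mk, coeff_mk, coeff_X]
    rcases n with _ | n <;> simp

/-- The generating function of the increasing permutations of size at least two. -/
theorem diagSum_two_le : diagSum (fun n => if 2 ≤ n then 1 else 0) = genFun (fun _ => 1) - X := by
  have h := diagSum_natCast (fun n => if 2 ≤ n then 1 else 0) rfl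
  have h' : (fun n => (((if 2 ≤ n then 1 else 0 : ℕ)) : ℚ⟦X⟧)) =
      fun n => if 2 ≤ n then 1 else 0 := by
    funext n
    split_ifs <;> simp
  rw [h'] at h
  rw [h]
  ext n
  rw [map_sub, genFun, genFun, coeff_mk, coeff_mk, coeff_X]
  rcases n with _ | _ | n <;> simp

theorem diagSum_topped_increasing :
    diagSum (weightSum (fun n π => (0 < n ∧ π = 1) ∧ IsTopped π) fun _ _ => 1) =
      genFun fun _ => 1 := by
  rw [diagSum_weightSum_one _ fun π h => h.1.1.false]
  ext n
  rw [genFun, genFun, coeff_mk, coeff_mk]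
  split_ifs with h
  · rfl
  congr 1
  rw [Nat.card_eq_one_iff_unique]
  exact ⟨⟨fun x y => Subtype.ext (x.2.1.2.trans y.2.1.2.symm)⟩,
    ⟨1, ⟨Nat.pos_of_ne_zero h, rfl⟩, fun i hi => hi⟩⟩

theorem genFun_pathCount_eq : genFun pathCount =
    diagSum (weightSum (fun _ π => IsTreeLike π ∧ ∀ i, vertexDegree π i ≤ 2) fun _ _ => 1) := by
  rw [diagSum_weightSum_one _ fun π h => not_isTreeLike_zero π h.1]
  ext n
  rw [genFun, genFun, coeff_mk, coeff_mk]
  split_ifs with h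
  · rfl
  · congr 1
    exact Nat.card_congr (Equiv.subtypeEquivRight (isPathLike_iff (Nat.pos_of_ne_zero h)))

theorem diagSum_siteSum_path :
    diagSum (siteSum (fun _ π => IsTreeLike π ∧ ∀ i, vertexDegree π i ≤ 2)
      (fun _ τ e => IsPathSite τ e) fun _ _ _ => 1) =
      genFun pathCount + (genFun (fun _ => 1) - X) := by
  rw [genFun_pathCount_eq, ← diagSum_two_le, ← diagSum_add]
  congr 1
  funext n
  rw [← weightSum_one_perm (fun _ π => IsTreeLike π ∧ ∀ i, vertexDegree π i ≤ 2) _ n two_pos,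
    siteSum, weightSum, weightSum, weightSum, ← Finset.sum_add_distrib]
  · refine Finset.sum_congr rfl fun π _ => ?_
    by_cases h : IsTreeLike π ∧ ∀ i, vertexDegree π i ≤ 2
    · rw [indic_pos h, indic_pos h, sum_isPathSite h]
      exact congrArg _ (indic_congr (and_iff_right h).symm fun _ => rfl)
    · rw [indic_neg h, indic_neg h, indic_neg fun h' => h h'.1, add_zero]
  · intro n hn
    obtain ⟨m, rfl⟩ := Nat.exists_eq_add_of_le' hn
    exact ⟨isTreeLike_one m, vertexDegree_one_le⟩

theorem genFun_pathCount_mul : genFun pathCount * ((1 - X) * (1 - 2 * X)) =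
    X * (1 - 2 * X + 2 * X ^ 2) := by
  have h1 := glueClass_isPathLike.diagSum_weightSum (fun _ _ => 1) (fun _ _ => 1)
    (fun _ _ _ => 1) (fun _ _ _ _ _ => rfl) fun _ _ _ _ _ _ _ _ _ => rfl
  rw [diagSum_topped_increasing, diagSum_siteSum_path, ← genFun_pathCount_eq] at h1
  linear_combination (1 - X) ^ 2 * h1 + (genFun pathCount * (1 - X) + X +
    genFun (fun _ => 1) * (1 - X) - X * (1 - X)) * genFun_one_mul

theorem pathCount_eq {n : ℕ} (hn : 2 ≤ n) : pathCount n = 2 ^ (n - 1) - 1 := by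
  have hD : genFun (fun n => 2 ^ (n - 1)) * (1 - 2 * X) = X := by
    ext n
    rcases n with _ | n
    · simp [genFun]
    · rw [mul_sub, mul_one, map_sub, mul_left_comm, ← mul_assoc, coeff_succ_mul_X,
        ← map_ofNat (C (R := ℚ)) 2, coeff_C_mul, genFun, coeff_mk, coeff_mk, coeff_X]
      rcases n with _ | n
      · simp
      · simp [pow_succ]
        ring
  have h : genFun pathCount + genFun (fun _ => 1) = genFun (fun n => 2 ^ (n - 1)) + X := by
    have h0 : (1 - X) * (1 - 2 * X) ≠ (0 : ℚ⟦X⟧) := fun h => by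
      simpa using congrArg constantCoeff h
    apply mul_right_cancel₀ h0
    linear_combination genFun_pathCount_mul + (1 - 2 * X) * genFun_one_mul - (1 - X) * hD
  have h' := congrArg (coeff n) h
  rw [map_add, map_add, genFun, genFun, genFun, coeff_mk, coeff_mk, coeff_mk, coeff_X,
    if_neg (by omega), if_neg (by omega), if_neg (by omega), if_neg (by omega), add_zero] at h'
  have h2 : pathCount n + 1 = 2 ^ (n - 1) := by exact_mod_cast h'
  omega

end pathSeries

/-- `w` below is `√(1 - 4x)`: the formal power series with square `1 - 4x` and constant term `1`
(these two conditions determine it). All series that are inverted have a nonzero constant term. -/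
theorem theorem3 :
    (∃ w : ℚ⟦X⟧, w ^ 2 = 1 - 4 * X ∧ constantCoeff w = 1 ∧
      genFun forestCount =
        ((1 - X) * (1 - 4 * X - 2 * X ^ 2) - (1 - 5 * X) * w) *
          (2 * (1 - 5 * X + 2 * X ^ 2 - X ^ 3))⁻¹ ∧
      genFun treeCount =
        (1 - 3 * X - 6 * X ^ 2 - (1 - 5 * X) * w) * (2 * (2 - 9 * X))⁻¹ ∧
      genFun rootedTreeCount = (1 - w) * (2 : ℚ⟦X⟧)⁻¹ ∧
      genFun pathCount =
        X * ((1 - 2 * X + 2 * X ^ 2) * ((1 - X) * (1 - 2 * X))⁻¹) ∧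
      genFun smoothCount =
        X * ((1 - 5 * X + 4 * X ^ 2 + X * w) *
          (1 - 6 * X + 8 * X ^ 2 - 4 * X ^ 3)⁻¹)) ∧
    (∀ n : ℕ, 1 ≤ n → rootedTreeCount n = catalan (n - 1)) ∧
    (∀ n : ℕ, 2 ≤ n → pathCount n = 2 ^ (n - 1) - 1) := by
  have hB := X_mul_catSeries_sq
  have hT := genFun_treeCount_mul
  have hF := genFun_forestCount_mul
  have hI := genFun_smooth_skewIndec_mul
  have hS := genFun_smoothCount_mul
  have hB0 : constantCoeff (X * catSeries) = 0 := by simp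
  have hX : (X : ℚ⟦X⟧) = X * catSeries * (1 - X * catSeries) := by
    linear_combination X * hB
  have hT0 := constantCoeff_genFun treeCount
  have hI0 := constantCoeff_genFun fun n =>
    Nat.card {π : Equiv.Perm (Fin n) // IsSmoothPerm π ∧ SkewIndec π}
  have hR := genFun_rootedTreeCount
  have hP := genFun_pathCount_mul
  generalize (genFun fun n =>
    Nat.card {π : Equiv.Perm (Fin n) // IsSmoothPerm π ∧ SkewIndec π}) = I at hI hS hI0
  generalize X * catSeries = B at *
  generalize genFun treeCount = T at *
  generalize genFun forestCount = F at *
  generalize genFun smoothCount = S at *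
  have hne : ∀ {f : ℚ⟦X⟧}, constantCoeff f ≠ 0 → f ≠ 0 := fun h h' => h (by rw [h', map_zero])
  have h2 : constantCoeff (2 : ℚ⟦X⟧) ≠ 0 := by
    rw [map_ofNat]
    norm_num
  refine ⟨⟨1 - 2 * B, ?_, ?_, ?_, ?_, ?_, ?_, ?_⟩, fun n => rootedTreeCount_eq_catalan,
    fun n => pathCount_eq⟩
  · linear_combination 4 * hX
  · simp [hB0]
  · rw [PowerSeries.eq_mul_inv_iff_mul_eq (by simp [h2])]
    have hF' : F * (1 - 4 * B + 3 * B ^ 2 - B ^ 3) = B * (1 - 3 * B + B ^ 2) := by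
      linear_combination (1 - 3 * B) * hF + (F + 1) * hT
    apply mul_left_cancel₀ (hne (f := 1 - 4 * B + 3 * B ^ 2 - B ^ 3) (by simp [hB0]))
    rw [hX]
    linear_combination 2 * (1 - 5 * (B * (1 - B)) + 2 * (B * (1 - B)) ^ 2 -
      (B * (1 - B)) ^ 3) * hF'
  · rw [PowerSeries.eq_mul_inv_iff_mul_eq (by simp [h2])]
    apply mul_left_cancel₀ (hne (f := 1 - 3 * B) (by simp [hB0]))
    rw [hX]
    linear_combination 2 * (2 - 9 * (B * (1 - B))) * hT
  · rw [PowerSeries.eq_mul_inv_iff_mul_eq h2, hR]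
    ring
  · rw [← mul_assoc, PowerSeries.eq_mul_inv_iff_mul_eq (by simp)]
    exact hP
  · rw [← mul_assoc, PowerSeries.eq_mul_inv_iff_mul_eq (by simp)]
    have hS' : S * ((1 - 3 * B + B ^ 2) - B * (1 - B) * (1 - 2 * B)) =
        B * (1 - B) * (1 - 2 * B) := by
      linear_combination (1 - 3 * B + B ^ 2) * hS + (S + 1) * hI
    apply mul_left_cancel₀
      (hne (f := (1 - 3 * B + B ^ 2) - B * (1 - B) * (1 - 2 * B)) (by simp [hB0]))
    rw [hX]
    linear_combination (1 - 6 * (B * (1 - B)) + 8 * (B * (1 - B)) ^ 2 -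
      4 * (B * (1 - B)) ^ 3) * hS'
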